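/- Let $p$ be a prime and $K$ a field with $\operatorname{char}K=p$. **Flies.** A *specie of flies* over the alphabet $\Theta_0=\{1,\dots,k\}$ is a set of words $\Theta=\bigcup_{n\ge0}\Theta_n$ with $\Theta_{n+1}\subset\{ab\mid a,b\in\Theta_n,\ a\ne b\}$ (concatenation) and $|\Theta_n|\ge3$ for all $n\ge0$ (so $k\ge 3$). The elements of $\Theta_n$ are the flies of generation $n$. **Uniform tuples.** A tuple $\bar S=(S_a\mid a\in\Theta)$ of positive integers is *uniform* if there are integers $(s_n,r_n\mid n\ge0)$ such that for every fly $bc\in\Theta_{n+1}$ with $b,c\in\Theta_n$ either $S_b=s_n,\ S_c=r_n$, or $S_b=r_n,\ S_c=s_n$. (This includes the tuples with $S_a=s_n$ for all $a\in\Theta_n$.) **The ring.** Let $R=R(\Theta,\bar S)$ be the commutative $K$-algebra with basis the formal monomials $\prod_{a\in\Theta}t_a^{(i_a)}$, where $0\le i_a<p^{S_a}$ and only finitely many $i_a$ are nonzero, and with product $$\prod_a t_a^{(i_a)}\cdot\prod_a t_a^{(j_a)}=\prod_a\binom{i_a+j_a}{i_a}t_a^{(i_a+j_a)},$$ the right-hand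 side being $0$ if $i_a+j_a\ge p^{S_a}$ for some $a$. Let $\partial_a\in\operatorname{Der}R$ be the derivation with $\partial_a(t_a^{(i)})=t_a^{(i-1)}$ for $i\ge1$ and $\partial_a(t_b^{(i)})=0$ for $b\ne a$, and also $\partial_a(1)=0$. **The algebra.** The *virtual pivot elements* $v_a\in\operatorname{Der}R$, $a\in\Theta$, are defined recursively by $$v_a=\partial_a+t_a^{(p^{S_a}-1)}\sum_{b\in\Theta_n,\ ab\in\Theta_{n+1}}t_b^{(p^{S_b}-1)}\,v_{ab},\qquad a\in\Theta_n,\ n\ge0,$$ that is, by the infinite sum of derivations obtained by expanding this recursion (it is finite on each element of $R$). Let $\mathcal L(\Theta,\bar S)=\operatorname{Lie}_p(v_1,\dots,v_k)\subset\operatorname{Der}R$ be the *drosophila restricted Lie algebra*: the smallest $K$-subspace of $\operatorname{Der}R$ that contains $v_1,\dots,v_k$ and is closed under the commutator and under the $p$-mapping $w\mapsto w^p$ ($p$-fold composition). **Theorem.** For every specie of flies $\Theta$ and every uniform tuple $\bar S$ the algebra $\mathcal L(\Theta,\bar S)$ has a nil $p$-mapping: for each $w\in\mathcal L(\Theta,\bar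 S)$ there is an integer $N\ge0$ with $w^{p^N}=0$. -/

import Mathlib

noncomputable section

/-- The product of binomial coefficients `∏ₐ ((ξₐ + ηₐ) choose ξₐ)`. -/
def multiBinom {ι : Type*} (ξ η : ι →₀ ℕ) : ℕ :=
  ξ.prod fun a i => (i + η a).choose i

/-- The set `Λ` of finitely supported exponent tuples `ξ` with `0 ≤ ξₐ < p ^ Sₐ`. -/
abbrev Expo {ι : Type*} (p : ℕ) (S : ι → ℕ) : Type _ :=
  {ξ : ι →₀ ℕ // ∀ a, ξ a < p ^ S a}

/-- The divided power series ring `R(Θ, S)`: the `K`-vector space whose basis is the set of formal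
symbols `∏ₐ tₐ^(ξₐ)` with `ξ ∈ Λ`. Its product is defined below. -/
def DPRing (K : Type*) [Field K] {ι : Type*} (p : ℕ) (S : ι → ℕ) : Type _ :=
  Expo p S →₀ K

namespace DPRing

variable {K : Type*} [Field K] {ι : Type*} {p : ℕ} {S : ι → ℕ}

instance : AddCommGroup (DPRing K p S) := inferInstanceAs (AddCommGroup (Expo p S →₀ K))

instance : Module K (DPRing K p S) := inferInstanceAs (Module K (Expo p S →₀ K))

/-- The basis of monomials `t^(ξ)`, `ξ ∈ Λ`. -/
def monoBasis : Module.Basis (Expo p S) K (DPRing K p S) :=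
  Module.Basis.ofRepr (LinearEquiv.refl K (Expo p S →₀ K))

open scoped Classical in
/-- The divided power monomial `t^(ξ) = ∏ₐ tₐ^(ξₐ)` if `ξ ∈ Λ`, and `0` for other exponents. -/
def mono (ξ : ι →₀ ℕ) : DPRing K p S :=
  if h : ∀ a, ξ a < p ^ S a then monoBasis ⟨ξ, h⟩ else 0

/-- The `K`-bilinear product with
`t^(ξ) * t^(η) = ∏ₐ ((ξₐ + ηₐ) choose ξₐ) • t^(ξ + η)` for `ξ, η ∈ Λ`;
the right-hand side is `0` if `ξ + η ∉ Λ`, as then the coefficient is divisible by `p`. -/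
def mulLin : DPRing K p S →ₗ[K] DPRing K p S →ₗ[K] DPRing K p S :=
  monoBasis.constr K fun ξ : Expo p S => monoBasis.constr K fun η : Expo p S =>
    (multiBinom ξ.1 η.1 : K) • mono (ξ.1 + η.1)

/-- The `K`-linear map `∂_d` with `∂_d (t_d^(i)) = t_d^(i - 1)`, acting on the variable `t_d`
only, where `t_d^(l) = 0` for `l < 0`. -/
def partialLin (d : ι) : DPRing K p S →ₗ[K] DPRing K p S :=
  monoBasis.constr K fun ξ : Expo p S =>
    if ξ.1 d = 0 then 0 else mono (ξ.1 - Finsupp.single d 1)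

section lemmas

theorem multiBinom_eq {ξ η : ι →₀ ℕ} (T : Finset ι) (hT : ξ.support ⊆ T) :
    multiBinom ξ η = ∏ a ∈ T, (ξ a + η a).choose (ξ a) := by
  unfold multiBinom
  rw [Finsupp.prod_of_support_subset _ hT]
  simp

theorem multiBinom_comm (ξ η : ι →₀ ℕ) : multiBinom ξ η = multiBinom η ξ := by
  classical
  rw [multiBinom_eq (ξ.support ∪ η.support) Finset.subset_union_left,
    multiBinom_eq (ξ.support ∪ η.support) Finset.subset_union_right]
  refine Finset.prod_congr rfl fun a _ => ?_
  rw [add_comm (η a), Nat.choose_symm_add]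

theorem multiBinom_zero (η : ι →₀ ℕ) : multiBinom 0 η = 1 := by
  simp [multiBinom]

theorem multiBinom_assoc (ξ η ζ : ι →₀ ℕ) :
    multiBinom ξ η * multiBinom (ξ + η) ζ = multiBinom η ζ * multiBinom ξ (η + ζ) := by
  classical
  have h1 : ξ.support ⊆ ξ.support ∪ η.support := Finset.subset_union_left
  have h2 : η.support ⊆ ξ.support ∪ η.support := Finset.subset_union_right
  rw [multiBinom_eq _ h1, multiBinom_eq _ Finsupp.support_add, multiBinom_eq _ h2,
    multiBinom_eq _ h1, ← Finset.prod_mul_distrib, ← Finset.prod_mul_distrib]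
  refine Finset.prod_congr rfl fun a _ => ?_
  simp only [Finsupp.add_apply]
  have h := @Nat.choose_mul (ξ a + η a + ζ a) (ξ a + η a) (ξ a) (by omega)
  rw [mul_comm, h, mul_comm]
  congr 2 <;> omega

theorem multiBinom_erase (d : ι) (ξ η : ι →₀ ℕ) :
    multiBinom ξ η = (ξ d + η d).choose (ξ d) * multiBinom (ξ.erase d) (η.erase d) := by
  classical
  rw [multiBinom_eq (insert d (ξ.support.erase d)) (by
      intro a ha
      by_cases h : a = d <;> simp_all),
    Finset.prod_insert (by simp), multiBinom_eq (ξ := ξ.erase d) (ξ.support.erase d) (by simp)]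
  congr 1
  refine Finset.prod_congr rfl fun a ha => ?_
  rw [Finsupp.erase_ne (Finset.ne_of_mem_erase ha), Finsupp.erase_ne (Finset.ne_of_mem_erase ha)]

theorem mono_val (ξ : Expo p S) : (mono ξ.1 : DPRing K p S) = monoBasis ξ := by
  rw [mono, dif_pos ξ.2]

theorem mono_of_not {ξ : ι →₀ ℕ} (h : ¬ ∀ a, ξ a < p ^ S a) : (mono ξ : DPRing K p S) = 0 :=
  dif_neg h

theorem mulLin_mono {ξ η : ι →₀ ℕ} (hξ : ∀ a, ξ a < p ^ S a) (hη : ∀ a, η a < p ^ S a) :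
    mulLin (mono ξ) (mono η) = (multiBinom ξ η : K) • (mono (ξ + η) : DPRing K p S) := by
  have h1 := mono_val (K := K) (⟨ξ, hξ⟩ : Expo p S)
  have h2 := mono_val (K := K) (⟨η, hη⟩ : Expo p S)
  simp only at h1 h2
  rw [h1, h2, mulLin, Module.Basis.constr_basis, Module.Basis.constr_basis]

theorem lin_ext {M : Type*} [AddCommGroup M] [Module K M] {f g : DPRing K p S →ₗ[K] M}
    (h : ∀ ξ : ι →₀ ℕ, (∀ a, ξ a < p ^ S a) → f (mono ξ) = g (mono ξ)) : f = g :=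
  monoBasis.ext fun ξ => by rw [← mono_val]; exact h ξ.1 ξ.2

theorem mulLin_comm (x y : DPRing K p S) : mulLin x y = mulLin y x := by
  have : (mulLin : DPRing K p S →ₗ[K] _) = mulLin.flip := by
    refine lin_ext fun ξ hξ => lin_ext fun η hη => ?_
    rw [LinearMap.flip_apply, mulLin_mono hξ hη, mulLin_mono hη hξ, multiBinom_comm, add_comm]
  conv_lhs => rw [this]
  rfl

theorem mulLin_mono_smul {ξ η ζ : ι →₀ ℕ} (hη : ∀ a, η a < p ^ S a)
    (hζ : ∀ a, ζ a < p ^ S a) :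
    mulLin (mono ξ) (mulLin (mono η) (mono ζ)) =
      ((multiBinom η ζ * multiBinom ξ (η + ζ) : ℕ) : K) •
        (mono (ξ + (η + ζ)) : DPRing K p S) := by
  rw [mulLin_mono hη hζ, map_smul]
  by_cases hξ : ∀ a, ξ a < p ^ S a
  · by_cases h : ∀ a, (η + ζ) a < p ^ S a
    · rw [mulLin_mono hξ h, smul_smul, Nat.cast_mul]
    · rw [mono_of_not h, mono_of_not (ξ := ξ + (η + ζ)), map_zero, smul_zero, smul_zero]
      contrapose! h
      intro a
      have := h a
      simp only [Finsupp.add_apply] at this ⊢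
      omega
  · rw [mono_of_not hξ, mono_of_not (ξ := ξ + (η + ζ))]
    · simp
    · contrapose! hξ
      intro a
      have := hξ a
      simp only [Finsupp.add_apply] at this
      omega

theorem mulLin_assoc (x y z : DPRing K p S) :
    mulLin (mulLin x y) z = mulLin x (mulLin y z) := by
  have h1 : ∀ ξ η : ι →₀ ℕ, (∀ a, ξ a < p ^ S a) → (∀ a, η a < p ^ S a) →
      (mulLin (mulLin (mono ξ) (mono η)) : DPRing K p S →ₗ[K] _) =
        mulLin (mono ξ) ∘ₗ mulLin (mono η) := fun ξ η hξ hη => lin_ext fun ζ hζ => by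
    rw [LinearMap.comp_apply, mulLin_comm _ (mono ζ), mulLin_mono_smul hξ hη,
      mulLin_mono_smul hη hζ, multiBinom_comm ζ, multiBinom_assoc, add_comm ζ, add_assoc]
  have h2 : ∀ ξ : ι →₀ ℕ, (∀ a, ξ a < p ^ S a) →
      (mulLin.flip z ∘ₗ mulLin (mono ξ) : DPRing K p S →ₗ[K] _) =
        mulLin (mono ξ) ∘ₗ mulLin.flip z :=
    fun ξ hξ => lin_ext fun η hη => LinearMap.congr_fun (h1 ξ η hξ hη) z
  have h3 : (mulLin.flip z ∘ₗ mulLin.flip y : DPRing K p S →ₗ[K] _) =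
      mulLin.flip (mulLin y z) :=
    lin_ext fun ξ hξ => LinearMap.congr_fun (h2 ξ hξ) y
  exact LinearMap.congr_fun h3 x

theorem partialLin_mono (d : ι) {ξ : ι →₀ ℕ} (hξ : ∀ a, ξ a < p ^ S a) :
    partialLin d (mono ξ : DPRing K p S) =
      if ξ d = 0 then 0 else mono (ξ - Finsupp.single d 1) := by
  have h1 := mono_val (K := K) (⟨ξ, hξ⟩ : Expo p S)
  simp only at h1
  rw [h1, partialLin, Module.Basis.constr_basis]

theorem bound_sub {ξ : ι →₀ ℕ} (hξ : ∀ a, ξ a < p ^ S a) (d : ι) (a : ι) :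
    (ξ - Finsupp.single d 1 : ι →₀ ℕ) a < p ^ S a :=
  lt_of_le_of_lt (by rw [Finsupp.tsub_apply]; exact Nat.sub_le _ _) (hξ a)

theorem finite_partialLin_ne_zero (x : DPRing K p S) : {d | partialLin d x ≠ 0}.Finite := by
  have hx : x ∈ Submodule.span K (Set.range (monoBasis (K := K) (p := p) (S := S))) := by
    rw [monoBasis.span_eq]
    exact Submodule.mem_top
  induction hx using Submodule.span_induction with
  | mem x h =>
    obtain ⟨ξ, rfl⟩ := h
    refine (ξ.1.support.finite_toSet).subset fun d hd => ?_
    rw [Set.mem_ofPred_eq, ← mono_val, partialLin_mono d ξ.2] at hd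
    simpa using (ite_ne_left_iff.mp hd).1
  | zero => simp
  | add x y _ _ hx hy =>
    refine (hx.union hy).subset fun d hd => ?_
    by_contra h
    simp only [Set.mem_union, Set.mem_ofPred_eq, not_or, not_not] at h hd
    exact hd (by rw [map_add, h.1, h.2, add_zero])
  | smul r x _ hx =>
    refine hx.subset fun d hd h => hd ?_
    rw [map_smul, h, smul_zero]

end lemmas

variable [Fact p.Prime]

theorem zero_lt_bound (a : ι) : (0 : ι →₀ ℕ) a < p ^ S a :=
  pow_pos (Fact.out : p.Prime).pos _

theorem mulLin_one (x : DPRing K p S) : mulLin (mono 0) x = x := by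
  have h : (mulLin (mono 0) : DPRing K p S →ₗ[K] _) = LinearMap.id :=
    lin_ext fun ξ hξ => by
      rw [mulLin_mono zero_lt_bound hξ, multiBinom_zero]
      simp
  rw [h]; rfl

instance : CommRing (DPRing K p S) :=
  { (inferInstance : AddCommGroup (DPRing K p S)) with
    mul := fun x y => mulLin x y
    one := mono 0
    mul_assoc := mulLin_assoc
    one_mul := mulLin_one
    mul_one := fun x => (mulLin_comm x _).trans (mulLin_one x)
    mul_comm := mulLin_comm
    left_distrib := fun x y z => map_add (mulLin x) y z
    right_distrib := fun x y z => by
      change mulLin (x + y) z = mulLin x z + mulLin y z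
      rw [map_add, LinearMap.add_apply]
    zero_mul := fun x => by
      change mulLin 0 x = 0
      rw [map_zero, LinearMap.zero_apply]
    mul_zero := fun x => map_zero (mulLin x) }

instance : Algebra K (DPRing K p S) :=
  Algebra.ofModule
    (fun r x y => by
      change mulLin (r • x) y = r • mulLin x y
      rw [map_smul, LinearMap.smul_apply])
    (fun r x y => map_smul (mulLin x) r y)

section leibniz

theorem mono_mul {ξ η : ι →₀ ℕ} (hξ : ∀ a, ξ a < p ^ S a) (hη : ∀ a, η a < p ^ S a) :
    (mono ξ * mono η : DPRing K p S) = (multiBinom ξ η : K) • mono (ξ + η) :=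
  mulLin_mono hξ hη

theorem mono_mul_sub (d : ι) {ξ η : ι →₀ ℕ} (hξ : ∀ a, ξ a < p ^ S a)
    (hη : ∀ a, η a < p ^ S a) (h : η d ≠ 0) :
    (mono ξ * mono (η - Finsupp.single d 1) : DPRing K p S) =
      (((ξ d + η d - 1).choose (ξ d) * multiBinom (ξ.erase d) (η.erase d) : ℕ) : K) •
        mono (ξ + η - Finsupp.single d 1) := by
  have h1 : (η - Finsupp.single d 1).erase d = η.erase d := by
    ext a
    by_cases ha : a = d
    · simp [ha]
    · simp [Finsupp.erase_ne ha, Finsupp.single_eq_of_ne ha]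
  have h2 : ξ + (η - Finsupp.single d 1) = ξ + η - Finsupp.single d 1 := by
    ext a
    by_cases ha : a = d
    · subst ha
      simp only [Finsupp.add_apply, Finsupp.tsub_apply, Finsupp.single_eq_same]
      omega
    · simp [Finsupp.single_eq_of_ne ha]
  rw [mono_mul hξ (bound_sub hη d), multiBinom_erase d, h1, h2]
  congr 4
  simp only [Finsupp.tsub_apply, Finsupp.single_eq_same]
  omega

theorem partialLin_mono_mul [CharP K p] (d : ι) {ξ η : ι →₀ ℕ} (hξ : ∀ a, ξ a < p ^ S a)
    (hη : ∀ a, η a < p ^ S a) :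
    partialLin d (mono ξ * mono η : DPRing K p S) =
      mono ξ * partialLin d (mono η) + mono η * partialLin d (mono ξ) := by
  set B := multiBinom (ξ.erase d) (η.erase d) with hB
  have hB' : multiBinom (η.erase d) (ξ.erase d) = B := multiBinom_comm _ _
  -- the right-hand side, computed with the Pascal rule
  have key : (mono ξ * partialLin d (mono η) + mono η * partialLin d (mono ξ) : DPRing K p S) =
      if ξ d + η d = 0 then 0 else
        (multiBinom ξ η : K) • mono (ξ + η - Finsupp.single d 1) := by
    rw [partialLin_mono d hξ, partialLin_mono d hη, multiBinom_erase d ξ η, ← hB]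
    by_cases h1 : ξ d = 0 <;> by_cases h2 : η d = 0
    · simp [h1, h2]
    · rw [if_pos h1, if_neg h2, if_neg (by omega), mono_mul_sub d hξ hη h2, ← hB, h1]
      simp
    · rw [if_neg h1, if_pos h2, if_neg (by omega), mono_mul_sub d hη hξ h1, hB', h2,
        add_comm η ξ]
      simp
    · rw [if_neg h1, if_neg h2, if_neg (by omega), mono_mul_sub d hξ hη h2, ← hB,
        mono_mul_sub d hη hξ h1, hB', add_comm η ξ, ← add_smul, ← Nat.cast_add, ← add_mul]
      congr 3
      obtain ⟨a, ha⟩ := Nat.exists_eq_succ_of_ne_zero h1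
      obtain ⟨b, hb⟩ := Nat.exists_eq_succ_of_ne_zero h2
      rw [ha, hb]
      have e1 : a.succ + b.succ - 1 = a + 1 + b := by omega
      have e2 : b.succ + a.succ - 1 = a + 1 + b := by omega
      have e3 : a.succ + b.succ = a + 1 + b + 1 := by omega
      rw [e1, e2, e3, Nat.succ_eq_add_one, Nat.succ_eq_add_one, Nat.choose_succ_succ]
      rw [show (a + 1 + b).choose (b + 1) = (a + 1 + b).choose a from
        Nat.choose_symm_of_eq_add (by omega)]
      ring
  rw [key, mono_mul hξ hη, map_smul]
  by_cases h : ∀ a, (ξ + η) a < p ^ S a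
  · rw [partialLin_mono d h, Finsupp.add_apply]
    split_ifs <;> simp
  · rw [mono_of_not h, map_zero, smul_zero]
    split_ifs with h0
    · rfl
    · by_cases h' : ∀ a, (ξ + η - Finsupp.single d 1 : ι →₀ ℕ) a < p ^ S a
      · have hd : ξ d + η d = p ^ S d := by
          by_contra hne
          refine h fun a => ?_
          have := h' a
          rw [Finsupp.tsub_apply] at this
          by_cases ha : a = d
          · subst ha
            simp only [Finsupp.add_apply, Finsupp.single_eq_same] at this ⊢
            omega
          · rwa [Finsupp.single_eq_of_ne ha, Nat.sub_zero] at this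
        have hdvd : p ∣ (ξ d + η d).choose (ξ d) := by
          rw [hd]
          have := hξ d
          have := hη d
          exact (Fact.out : p.Prime).dvd_choose_pow (by omega) (by omega)
        have : ((multiBinom ξ η : ℕ) : K) = 0 := by
          rw [CharP.cast_eq_zero_iff K p, multiBinom_erase d]
          exact Dvd.dvd.mul_right hdvd _
        rw [this, zero_smul]
      · rw [mono_of_not h', smul_zero]

theorem partialLin_mul [CharP K p] (d : ι) (x y : DPRing K p S) :
    partialLin d (x * y) = x * partialLin d y + y * partialLin d x := by
  have h1 : ∀ ξ : ι →₀ ℕ, (∀ a, ξ a < p ^ S a) →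
      (partialLin d ∘ₗ LinearMap.mulLeft K (mono ξ) : DPRing K p S →ₗ[K] _) =
        LinearMap.mulLeft K (mono ξ) ∘ₗ partialLin d +
          LinearMap.mulRight K (partialLin d (mono ξ)) :=
    fun ξ hξ => lin_ext fun η hη => partialLin_mono_mul d hξ hη
  have h2 : (partialLin d ∘ₗ LinearMap.mulRight K y : DPRing K p S →ₗ[K] _) =
      LinearMap.mulRight K (partialLin d y) + LinearMap.mulLeft K y ∘ₗ partialLin d :=
    lin_ext fun ξ hξ => LinearMap.congr_fun (h1 ξ hξ) y
  exact LinearMap.congr_fun h2 x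

end leibniz

/-- The partial derivation `∂_d` of `R(Θ, S)`. -/
def partialDer [CharP K p] (d : ι) : Derivation K (DPRing K p S) (DPRing K p S) :=
  Derivation.mk' (partialLin d) (partialLin_mul d)

theorem finite_mul_partialDer [CharP K p] (f : ι → DPRing K p S) (x : DPRing K p S) :
    (Function.support fun d => f d * partialDer d x).Finite :=
  (finite_partialLin_ne_zero x).subset (Function.support_mul_subset_right _ _)

/-- The derivation `∑_d f_d ∂_d` attached to an arbitrary family of coefficients `f_d` in the ring:
the sum is infinite, but on each element of the ring only finitely many terms are nonzero. -/
def sumPartial [CharP K p] (f : ι → DPRing K p S) : Derivation K (DPRing K p S) (DPRing K p S) :=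
  Derivation.mk'
    { toFun := fun x => ∑ᶠ d, f d * partialDer d x
      map_add' := fun x y => by
        rw [← finsum_add_distrib (finite_mul_partialDer f x) (finite_mul_partialDer f y)]
        exact finsum_congr fun d => by rw [map_add, mul_add]
      map_smul' := fun r x => by
        rw [RingHom.id_apply, smul_finsum]
        exact finsum_congr fun d => by rw [Derivation.map_smul, mul_smul_comm] }
    fun x y => by
      change ∑ᶠ d, f d * partialDer d (x * y) =
        x * ∑ᶠ d, f d * partialDer d y + y * ∑ᶠ d, f d * partialDer d x
      rw [mul_finsum' _ _ (finite_mul_partialDer f y), mul_finsum' _ _ (finite_mul_partialDer f x),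
        ← finsum_add_distrib
          ((finite_mul_partialDer f y).subset (Function.support_mul_subset_right (fun _ => x) _))
          ((finite_mul_partialDer f x).subset (Function.support_mul_subset_right (fun _ => y) _))]
      refine finsum_congr fun d => ?_
      rw [Derivation.leibniz, smul_eq_mul, smul_eq_mul]
      ring

end DPRing

section Restricted

variable {K A : Type*} [Field K] [CommRing A] [Algebra K A]

theorem derivation_pow_mul (D : Derivation K A A) (n : ℕ) (a b : A) :
    ((D : Module.End K A) ^ n) (a * b) = ∑ ij ∈ Finset.HasAntidiagonal.antidiagonal n,
      (n.choose ij.1 : A) * (((D : Module.End K A) ^ ij.1) a *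
        ((D : Module.End K A) ^ ij.2) b) := by
  induction n with
  | zero => simp
  | succ n ih =>
    rw [Finset.sum_antidiagonal_choose_succ_mul
      (fun i j => ((D : Module.End K A) ^ i) a * ((D : Module.End K A) ^ j) b),
      pow_succ', Module.End.mul_apply, ih, map_sum, ← Finset.sum_add_distrib]
    refine Finset.sum_congr rfl fun ij hij => ?_
    have hc : n.choose ij.2 = n.choose ij.1 :=
      Nat.choose_symm_of_eq_add (by rw [← Finset.HasAntidiagonal.mem_antidiagonal.mp hij, add_comm])
    simp only [pow_succ', Module.End.mul_apply, Derivation.coeFn_coe, Derivation.leibniz,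
      Derivation.map_natCast, smul_eq_mul, hc]
    ring

/-- The `p`-mapping `D ↦ D ^ p` (`p`-fold composition) of the restricted Lie algebra `Der A` in
characteristic `p`. -/
def pMap (p : ℕ) [Fact p.Prime] [CharP K p] (D : Derivation K A A) : Derivation K A A :=
  Derivation.mk' ((D : Module.End K A) ^ p) fun a b => by
    have hp := (Fact.out : p.Prime)
    have h0 : (p : A) = 0 := by
      rw [← map_natCast (algebraMap K A), CharP.cast_eq_zero, map_zero]
    rw [derivation_pow_mul, Finset.Nat.sum_antidiagonal_eq_sum_range_succ_mk,
      Finset.sum_range_succ, Finset.sum_eq_single_of_mem 0 (Finset.mem_range.mpr hp.pos)]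
    · simp [mul_comm]
    · intro i hi hi0
      obtain ⟨c, hc⟩ := hp.dvd_choose_self hi0 (Finset.mem_range.mp hi)
      simp only
      rw [hc, Nat.cast_mul, h0, zero_mul, zero_mul]

/-- `Lie_p(X)`: the restricted subalgebra of `Der A` generated by `X`, that is, the smallest
Lie subalgebra that contains `X` and is closed under the `p`-mapping. -/
def restrictedLieSpan (p : ℕ) [Fact p.Prime] [CharP K p] (X : Set (Derivation K A A)) :
    LieSubalgebra K (Derivation K A A) :=
  sInf {H | X ⊆ H ∧ ∀ D ∈ H, pMap p D ∈ H}

end Restricted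

/-- A specie of flies over the alphabet `{1, …, k}`. `gen n` is the set of flies of generation `n`,
which are words of length `2 ^ n`; each generation has at least three flies. -/
structure Specie (k : ℕ) where
  gen : ℕ → Finset (List (Fin k))
  gen_zero : gen 0 = Finset.univ.image fun i => [i]
  gen_succ : ∀ n, ∀ w ∈ gen (n + 1), ∃ a ∈ gen n, ∃ b ∈ gen n, a ≠ b ∧ w = a ++ b
  three_le : ∀ n, 3 ≤ (gen n).card

namespace Specie

variable {k : ℕ} (Θ : Specie k)

/-- The flies of a specie `Θ = ⋃ₙ Θₙ` (words in different generations have different lengths, so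
that the union is disjoint). -/
abbrev Fly : Type := Σ n, Θ.gen n

variable {Θ}

/-- A fly of generation `n`, seen as an element of `Θ`. -/
abbrev fly {n : ℕ} (a : Θ.gen n) : Θ.Fly := ⟨n, a⟩

/-- The fly `ab` of generation `n + 1`, when it is selected. -/
abbrev child {n : ℕ} {a b : Θ.gen n} (h : a.1 ++ b.1 ∈ Θ.gen (n + 1)) : Θ.gen (n + 1) :=
  ⟨a.1 ++ b.1, h⟩

/-- Uniform tuples: there are integers `sₙ, rₙ` such that for each fly `bc` of generation `n + 1`
with parents `b, c` either `S_b = sₙ, S_c = rₙ` or `S_b = rₙ, S_c = sₙ`. This includes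
the tuples with `S_a = sₙ` for all flies `a` of generation `n`. -/
def IsUniform (S : Θ.Fly → ℕ) : Prop :=
  ∃ s r : ℕ → ℕ, ∀ n (b c : Θ.gen n), b.1 ++ c.1 ∈ Θ.gen (n + 1) →
    (S (fly b) = s n ∧ S (fly c) = r n) ∨ (S (fly b) = r n ∧ S (fly c) = s n)

variable (K : Type*) [Field K] (p : ℕ) (S : Θ.Fly → ℕ)

/-- The variable `t_a` in its maximal divided power `p ^ S_a - 1`. -/
def topPow (a : Θ.Fly) : DPRing K p S :=
  DPRing.mono (Finsupp.single a (p ^ S a - 1))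

variable [Fact p.Prime]

open scoped Classical in
/-- The coefficient at `∂_d` of the expansion of `v_a` after the first `j` steps of the recursion
`v_a = ∂_a + t_a^(max) ∑_b t_b^(max) v_{ab}` (terms beyond those steps are cut off). -/
def pivotCoeffAux : ℕ → ∀ {n : ℕ}, Θ.gen n → Θ.Fly → DPRing K p S
  | 0, _, _, _ => 0
  | j + 1, n, a, d => (if fly a = d then 1 else 0) +
      topPow K p S (fly a) * ∑ b : Θ.gen n,
        if h : a.1 ++ b.1 ∈ Θ.gen (n + 1) then
          topPow K p S (fly b) * pivotCoeffAux j (child h) d else 0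

/-- The coefficient at `∂_d` of the virtual pivot element `v_a`; for `d` of generation `m` the
expansion is stationary from step `m + 1` on. -/
def pivotCoeff {n : ℕ} (a : Θ.gen n) (d : Θ.Fly) : DPRing K p S :=
  pivotCoeffAux K p S (d.1 + 1) a d

theorem pivotCoeffAux_stable (j : ℕ) {n : ℕ} (a : Θ.gen n) (d : Θ.Fly) (h : d.1 < n + j) :
    pivotCoeffAux K p S (j + 1) a d = pivotCoeffAux K p S j a d := by
  induction j generalizing n with
  | zero =>
    have h1 : fly a ≠ d := by
      rintro rfl
      exact lt_irrefl _ h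
    simp [pivotCoeffAux, h1]
  | succ j ih =>
    rw [pivotCoeffAux, pivotCoeffAux]
    congr 2
    refine Finset.sum_congr rfl fun b _ => ?_
    split_ifs with hb
    · rw [ih _ (by omega)]
    · rfl

open scoped Classical in
theorem pivotCoeff_eq {n : ℕ} (a : Θ.gen n) (d : Θ.Fly) :
    pivotCoeff K p S a d = (if fly a = d then 1 else 0) +
      topPow K p S (fly a) * ∑ b : Θ.gen n,
        if h : a.1 ++ b.1 ∈ Θ.gen (n + 1) then
          topPow K p S (fly b) * pivotCoeff K p S (child h) d else 0 := by
  rw [pivotCoeff, ← pivotCoeffAux_stable K p S _ a d (by omega), pivotCoeffAux]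
  rfl

variable [CharP K p]

/-- The virtual pivot element `v_a`, given by its expansion as an infinite sum of derivations.
It satisfies the defining recursion, see `pivot_eq`. -/
def pivot {n : ℕ} (a : Θ.gen n) : Derivation K (DPRing K p S) (DPRing K p S) :=
  DPRing.sumPartial fun d => pivotCoeff K p S a d

open scoped Classical in
/-- The recursion that defines the virtual pivot elements:
`v_a = ∂_a + t_a^(p ^ S_a - 1) ∑_b t_b^(p ^ S_b - 1) v_{ab}`, where the sum is over those `b` in the
generation of `a` with `ab ∈ Θ`. -/
theorem pivot_eq {n : ℕ} (a : Θ.gen n) :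
    pivot K p S a = DPRing.partialDer (fly a) + topPow K p S (fly a) • ∑ b : Θ.gen n,
      if h : a.1 ++ b.1 ∈ Θ.gen (n + 1) then topPow K p S (fly b) • pivot K p S (child h)
      else 0 := by
  ext x
  obtain ⟨T, hT⟩ : ∃ T : Finset Θ.Fly, ∀ d, d ∉ T → DPRing.partialDer (K := K) d x = 0 :=
    ⟨(DPRing.finite_partialLin_ne_zero x).toFinset, fun d hd => by
      by_contra h
      exact hd ((Set.Finite.mem_toFinset _).mpr h)⟩
  have hsum : ∀ {m : ℕ} (c : Θ.gen m), pivot K p S c x =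
      ∑ d ∈ T, pivotCoeff K p S c d * DPRing.partialDer d x := fun c =>
    finsum_eq_sum_of_support_subset _ fun d hd => by
      by_contra h
      exact hd (by simp only [hT d h, mul_zero])
  have h1 : DPRing.partialDer (fly a) x =
      ∑ d ∈ T, (if fly a = d then 1 else 0) * DPRing.partialDer (K := K) d x := by
    simp only [ite_mul, one_mul, zero_mul, Finset.sum_ite_eq]
    split_ifs with h
    · rfl
    · exact hT _ h
  have hder : ∀ f : Θ.gen n → Derivation K (DPRing K p S) (DPRing K p S),
      (∑ b, f b) x = ∑ b, f b x := fun f => by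
    have := congrFun (map_sum Derivation.coeFnAddMonoidHom f Finset.univ) x
    rwa [Finset.sum_apply] at this
  have h2 : (∑ b : Θ.gen n, if h : a.1 ++ b.1 ∈ Θ.gen (n + 1) then
        topPow K p S (fly b) • pivot K p S (child h) else 0) x =
      ∑ d ∈ T, (∑ b : Θ.gen n, if h : a.1 ++ b.1 ∈ Θ.gen (n + 1) then
        topPow K p S (fly b) * pivotCoeff K p S (child h) d else 0) * DPRing.partialDer d x := by
    simp only [Finset.sum_mul]
    rw [Finset.sum_comm, hder]
    refine Finset.sum_congr rfl fun b _ => ?_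
    split_ifs with h
    · rw [Derivation.smul_apply, hsum, smul_eq_mul, Finset.mul_sum]
      exact Finset.sum_congr rfl fun d _ => (mul_assoc _ _ _).symm
    · simp
  rw [Derivation.add_apply, Derivation.smul_apply, h1, h2, hsum, smul_eq_mul, Finset.mul_sum,
    ← Finset.sum_add_distrib]
  refine Finset.sum_congr rfl fun d _ => ?_
  rw [pivotCoeff_eq]
  ring

/-- The drosophila restricted Lie algebra `L(Θ, S) = Lie_p(v_1, …, v_k)`, generated by the virtual
pivot elements of generation zero. -/
def drosophila : LieSubalgebra K (Derivation K (DPRing K p S) (DPRing K p S)) :=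
  restrictedLieSpan p (Set.range fun a : Θ.gen 0 => pivot K p S a)

end Specie

end

/-! Sums, commutators and `p`-th powers of derivations keep them inside spans of nonempty words of
bounded length in the pivot elements, so every element of the algebra is a derivation in such a span
for generation 0 (`drosophila_subset`). It suffices that a derivation `w` in the span of words of
length at most `D` in the `v_a` of generation `n` is nil. This goes by strong induction on `D`, for
all `n` at once: a power of `w` is traded for a shorter element of the next generation.

Weights. Put `s = max(s_n, r_n)` and `lam = p^(s_n) + p^(r_n) - 1`, so that `p^s < lam`. On the
variables of generation greater than `n`, a word in the `v_a` becomes a sum of maps `t^ξ y`, with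
`t^ξ` a monomial of generation `n` and `y` a product of `E` pivot elements of generation `n + 1`.
One more factor `v_a` either differentiates `t^ξ`, which lowers `|ξ|` by 1, or acts as `t_a^max
t_b^max v_{ab}`, which raises `E` by 1 and `|ξ|` by `lam - 1`. Both raise `lam * E - |ξ|` by 1;
uniformity makes this cost the same for all flies `ab`. Hence words of length `D` satisfy `lam * E ≤
D + |ξ|` (`pivotWords_le_weightRestrict`), and in `w^(p^s)` the terms with `ξ = 0` have `E ≤ p^s D /
lam < D`.

Contraction. On variables of generation `n` the `v_a` act as commuting partial derivatives, so `W =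
w^(p^s)` kills those with `S_d ≤ s` and is linear over them. On the later variables `W` agrees,
modulo positive degree in them, with the part `y` where `ξ = 0`. This `y` is again a derivation,
hence nilpotent by induction, so a power of `W` raises the degree in finitely many truncated
variables, and `W` is nilpotent there (`exists_pow_apply_eq_zero`). Earlier variables are killed by
`w`, those of generation `n` by a power of it, and a derivation vanishing on all three groups is
zero. -/

noncomputable section

namespace DPRing

/-! ### Spans of monomials and splitting by groups of variables -/

section monoSpan

variable {K : Type*} [Field K] {ι : Type*} {p : ℕ} {S : ι → ℕ}

/-- The span of the monomials with exponents in a given set. -/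
def monoSpan (P : Set (ι →₀ ℕ)) : Submodule K (DPRing K p S) :=
  Submodule.span K (mono '' P)

/-- The exponents that involve only the variables in `V`. -/
def expoIn (V : Set ι) : Set (ι →₀ ℕ) := {ξ | ∀ a, ξ a ≠ 0 → a ∈ V}

theorem mono_mem_monoSpan {P : Set (ι →₀ ℕ)} {ξ : ι →₀ ℕ} (h : ξ ∈ P) :
    (mono ξ : DPRing K p S) ∈ monoSpan P :=
  Submodule.subset_span ⟨ξ, h, rfl⟩

theorem monoSpan_mono {P Q : Set (ι →₀ ℕ)} (h : P ⊆ Q) :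
    (monoSpan P : Submodule K (DPRing K p S)) ≤ monoSpan Q :=
  Submodule.span_mono (Set.image_mono h)

theorem monoSpan_le {P : Set (ι →₀ ℕ)} {M : Submodule K (DPRing K p S)}
    (h : ∀ ξ ∈ P, mono ξ ∈ M) : monoSpan P ≤ M :=
  Submodule.span_le.mpr (by rintro _ ⟨ξ, hξ, rfl⟩; exact h ξ hξ)

theorem map_mem_of_mono {P : Set (ι →₀ ℕ)} {M : Submodule K (DPRing K p S)}
    (T : DPRing K p S →ₗ[K] DPRing K p S) (h : ∀ ξ ∈ P, T (mono ξ) ∈ M)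
    {x : DPRing K p S} (hx : x ∈ monoSpan P) : T x ∈ M :=
  (monoSpan_le (M := M.comap T) h) hx

theorem eq_of_mono {P : Set (ι →₀ ℕ)} {T T' : DPRing K p S →ₗ[K] DPRing K p S}
    (h : ∀ ξ ∈ P, T (mono ξ) = T' (mono ξ))
    {x : DPRing K p S} (hx : x ∈ monoSpan P) : T x = T' x :=
  (monoSpan_le (M := LinearMap.eqLocus T T') h) hx

theorem repr_eq_zero_of_mem {P : Set (ι →₀ ℕ)} {x : DPRing K p S} (hx : x ∈ monoSpan P)
    {ξ : Expo p S} (hξ : ξ.1 ∉ P) : monoBasis.repr x ξ = 0 := by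
  classical
  refine Submodule.span_induction (p := fun x _ => monoBasis.repr x ξ = 0) ?_ ?_ ?_ ?_ hx
  · rintro _ ⟨η, hη, rfl⟩
    by_cases h : ∀ a, η a < p ^ S a
    · have := mono_val (K := K) (⟨η, h⟩ : Expo p S)
      simp only at this
      rw [this, Module.Basis.repr_self, Finsupp.single_apply, if_neg]
      rintro rfl
      exact hξ hη
    · rw [mono_of_not h]; simp
  · simp
  · intro x y _ _ hx hy
    rw [map_add, Finsupp.add_apply, hx, hy, add_zero]
  · intro r x _ hx
    rw [map_smul, Finsupp.smul_apply, hx, smul_zero]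

theorem eq_zero_of_mem_of_disjoint {P Q : Set (ι →₀ ℕ)} (h : Disjoint P Q)
    {x : DPRing K p S} (hP : x ∈ monoSpan P) (hQ : x ∈ monoSpan Q) : x = 0 := by
  refine monoBasis.ext_elem fun ξ => ?_
  rw [map_zero, Finsupp.zero_apply]
  by_cases hξ : ξ.1 ∈ P
  · exact repr_eq_zero_of_mem hQ (Set.disjoint_left.mp h hξ)
  · exact repr_eq_zero_of_mem hP hξ

theorem mem_expoIn_iff {V : Set ι} {ξ : ι →₀ ℕ} : ξ ∈ expoIn V ↔ ∀ a, a ∉ V → ξ a = 0 :=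
  forall_congr' fun _ => not_imp_comm

theorem add_mem_expoIn {V : Set ι} {ξ η : ι →₀ ℕ} (hξ : ξ ∈ expoIn V) (hη : η ∈ expoIn V) :
    ξ + η ∈ expoIn V := by
  rw [mem_expoIn_iff] at *
  intro a ha
  simp [hξ a ha, hη a ha]

theorem sub_mem_expoIn {V : Set ι} {ξ : ι →₀ ℕ} (η : ι →₀ ℕ) (hξ : ξ ∈ expoIn V) :
    ξ - η ∈ expoIn V := by
  rw [mem_expoIn_iff] at *
  intro a ha
  simp [hξ a ha]

theorem single_mem_expoIn {V : Set ι} {a : ι} (ha : a ∈ V) (i : ℕ) :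
    Finsupp.single a i ∈ expoIn V := by
  rw [mem_expoIn_iff]
  rintro b hb
  exact Finsupp.single_eq_of_ne (fun h => hb (h ▸ ha))

theorem expoIn_mono {V W : Set ι} (h : V ⊆ W) : expoIn V ⊆ expoIn W :=
  fun _ hξ a ha => h (hξ a ha)

theorem zero_mem_expoIn (V : Set ι) : (0 : ι →₀ ℕ) ∈ expoIn V := fun _ h => (h rfl).elim

variable [Fact p.Prime]

theorem exists_mono_mul (ξ η : ι →₀ ℕ) :
    ∃ c : K, (mono ξ * mono η : DPRing K p S) = c • mono (ξ + η) := by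
  by_cases hξ : ∀ a, ξ a < p ^ S a
  · by_cases hη : ∀ a, η a < p ^ S a
    · exact ⟨_, mono_mul hξ hη⟩
    · exact ⟨0, by rw [mono_of_not hη, mul_zero, zero_smul]⟩
  · exact ⟨0, by rw [mono_of_not hξ, zero_mul, zero_smul]⟩

theorem mul_mem_monoSpan {P Q R : Set (ι →₀ ℕ)} (h : ∀ ξ ∈ P, ∀ η ∈ Q, ξ + η ∈ R)
    {x y : DPRing K p S} (hx : x ∈ monoSpan P) (hy : y ∈ monoSpan Q) : x * y ∈ monoSpan R := by
  refine map_mem_of_mono (LinearMap.mulRight K y) (fun ξ hξ => ?_) hx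
  refine map_mem_of_mono (LinearMap.mulLeft K (mono ξ)) (fun η hη => ?_) hy
  obtain ⟨c, hc⟩ := exists_mono_mul (K := K) (p := p) (S := S) ξ η
  rw [LinearMap.mulLeft_apply, hc]
  exact Submodule.smul_mem _ _ (mono_mem_monoSpan (h ξ hξ η hη))

theorem mul_mem_expoIn {V : Set ι} {x y : DPRing K p S} (hx : x ∈ monoSpan (expoIn V))
    (hy : y ∈ monoSpan (expoIn V)) : x * y ∈ monoSpan (expoIn V) :=
  mul_mem_monoSpan (fun _ hξ _ hη => add_mem_expoIn hξ hη) hx hy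

theorem mono_zero : (mono 0 : DPRing K p S) = 1 := rfl

instance : Nontrivial (DPRing K p S) where
  exists_pair_ne := by
    refine ⟨mono 0, 0, ?_⟩
    rw [mono, dif_pos zero_lt_bound]
    exact monoBasis.ne_zero _

-- Lets the Frobenius identity for commuting elements be applied to endomorphisms.
instance [CharP K p] : CharP (Module.End K (DPRing K p S)) p :=
  charP_of_injective_algebraMap (algebraMap K (Module.End K (DPRing K p S))).injective p

open scoped Classical in
-- The two factors share no variable, so every binomial coefficient in the product is 1.
theorem mono_filter_mul (V : Set ι) {ξ : ι →₀ ℕ} (hξ : ∀ a, ξ a < p ^ S a) :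
    (mono (ξ.filter (· ∈ V)) * mono (ξ.filter (· ∉ V)) : DPRing K p S) = mono ξ := by
  have hle : ∀ (P : ι → Prop) [DecidablePred P] a, ξ.filter P a < p ^ S a := fun P _ a => by
    rw [Finsupp.filter_apply]
    split_ifs
    · exact hξ a
    · exact zero_lt_bound (ι := ι) a
  have h1 : multiBinom (ξ.filter (· ∈ V)) (ξ.filter (· ∉ V)) = 1 := by
    refine Finset.prod_eq_one fun a ha => ?_
    have : a ∈ V := by
      by_contra h
      simp [h] at ha
    simp [this]
  rw [mono_mul (hle (· ∈ V)) (hle (· ∉ V)), h1, Nat.cast_one, one_smul]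
  congr 1
  ext a
  by_cases h : a ∈ V <;> simp

theorem exists_mono_eq_mul (V : Set ι) {ξ : ι →₀ ℕ} (hξ : ∀ a, ξ a < p ^ S a) :
    ∃ ξ₁ ξ₂ : ι →₀ ℕ, (∀ a, ξ₁ a ≠ 0 → a ∈ V ∧ ξ a ≠ 0) ∧ (∀ a, ξ₂ a ≠ 0 → a ∉ V ∧ ξ a ≠ 0) ∧
      (mono ξ : DPRing K p S) = mono ξ₁ * mono ξ₂ := by
  classical
  refine ⟨_, _, ?_, ?_, (mono_filter_mul V hξ).symm⟩ <;>
  · intro a ha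
    rw [Finsupp.filter_apply] at ha
    simpa using ha

/-- A monomial splits into a factor in `V` and a factor outside `V`, hence in `W`; the Leibniz rule
does the rest. -/
theorem derivation_mono_eq_zero (D : Derivation K (DPRing K p S) (DPRing K p S)) {V W : Set ι}
    (hV : ∀ ξ ∈ expoIn V, D (mono ξ) = 0) (hW : ∀ ξ ∈ expoIn W, D (mono ξ) = 0)
    {ξ : ι →₀ ℕ} (hξ : ξ ∈ expoIn (V ∪ W)) : D (mono ξ) = 0 := by
  by_cases hb : ∀ a, ξ a < p ^ S a
  · obtain ⟨ξ₁, ξ₂, h₁, h₂, h⟩ := exists_mono_eq_mul (K := K) V hb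
    rw [h, Derivation.leibniz, hV ξ₁ fun a ha => (h₁ a ha).1,
      hW ξ₂ fun a ha => (hξ a (h₂ a ha).2).resolve_left (h₂ a ha).1, smul_zero, smul_zero, add_zero]
  · rw [mono_of_not hb, map_zero]

theorem derivation_eq_zero {D : Derivation K (DPRing K p S) (DPRing K p S)}
    (h : ∀ ξ, D (mono ξ) = 0) : D = 0 := by
  have : (D : DPRing K p S →ₗ[K] DPRing K p S) = 0 := lin_ext fun ξ _ => h ξ
  ext x
  exact LinearMap.congr_fun this x

/-- A linear map which satisfies the Leibniz rule on the subring of a set of variables and which is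
linear over the monomials in the other variables satisfies the Leibniz rule everywhere. -/
theorem leibniz_of_expoIn {V : Set ι} (T : DPRing K p S →ₗ[K] DPRing K p S)
    (hT : ∀ ξ ∈ expoIn V, ∀ η ∈ expoIn V,
      T (mono ξ * mono η) = mono ξ * T (mono η) + mono η * T (mono ξ))
    (hlin : ∀ ξ ∈ expoIn Vᶜ, ∀ x, T (mono ξ * x) = mono ξ * T x) (x y : DPRing K p S) :
    T (x * y) = x * T y + y * T x := by
  have h1 : ∀ ξ : ι →₀ ℕ, (∀ a, ξ a < p ^ S a) →
      (T ∘ₗ LinearMap.mulLeft K (mono ξ) : DPRing K p S →ₗ[K] _) =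
        LinearMap.mulLeft K (mono ξ) ∘ₗ T + LinearMap.mulRight K (T (mono ξ)) := by
    refine fun ξ hξ => lin_ext fun η hη => ?_
    simp only [LinearMap.comp_apply, LinearMap.add_apply, LinearMap.mulLeft_apply,
      LinearMap.mulRight_apply]
    obtain ⟨ξ₁, ξ₂, h₁, h₂, hξe⟩ := exists_mono_eq_mul (K := K) V hξ
    obtain ⟨η₁, η₂, g₁, g₂, hηe⟩ := exists_mono_eq_mul (K := K) V hη
    have k₁ : ξ₁ ∈ expoIn V := fun a ha => (h₁ a ha).1
    have k₂ : ξ₂ ∈ expoIn Vᶜ := fun a ha => (h₂ a ha).1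
    have l₁ : η₁ ∈ expoIn V := fun a ha => (g₁ a ha).1
    have l₂ : η₂ ∈ expoIn Vᶜ := fun a ha => (g₂ a ha).1
    -- The factors outside `V` are moved to the front and pulled out by linearity, which leaves the
    -- Leibniz rule inside `V`.
    rw [hξe, hηe, show (mono ξ₁ * mono ξ₂ * (mono η₁ * mono η₂) : DPRing K p S) =
      mono ξ₂ * (mono η₂ * (mono ξ₁ * mono η₁)) by ring, hlin _ k₂, hlin _ l₂, hT _ k₁ _ l₁,
      mul_comm (mono ξ₁) (mono ξ₂), mul_comm (mono η₁) (mono η₂), hlin _ k₂, hlin _ l₂]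
    ring
  have h2 : (T ∘ₗ LinearMap.mulRight K y : DPRing K p S →ₗ[K] _) =
      LinearMap.mulRight K (T y) + LinearMap.mulLeft K y ∘ₗ T := by
    refine lin_ext fun ξ hξ => ?_
    have := LinearMap.congr_fun (h1 ξ hξ) y
    simpa [mul_comm] using this
  simpa using LinearMap.congr_fun h2 x

end monoSpan

/-! ### Partial derivatives: commutation and nilpotency -/

section partialDer

variable {K : Type*} [Field K] {ι : Type*} {p : ℕ} {S : ι → ℕ} [Fact p.Prime] [CharP K p]

theorem partialDer_mono (d : ι) {ξ : ι →₀ ℕ} (hξ : ∀ a, ξ a < p ^ S a) :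
    partialDer d (mono ξ : DPRing K p S) =
      if ξ d = 0 then 0 else mono (ξ - Finsupp.single d 1) :=
  partialLin_mono d hξ

theorem partialDer_mono_eq_zero {d : ι} {ξ : ι →₀ ℕ} (hd : ξ d = 0) :
    partialDer d (mono ξ : DPRing K p S) = 0 := by
  by_cases hb : ∀ a, ξ a < p ^ S a
  · rw [partialDer_mono d hb, if_pos hd]
  · rw [mono_of_not hb, map_zero]

theorem partialDer_mem_monoSpan {P : Set (ι →₀ ℕ)} (d : ι)
    (hP : ∀ ξ ∈ P, ξ d ≠ 0 → ξ - Finsupp.single d 1 ∈ P) {x : DPRing K p S}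
    (hx : x ∈ monoSpan P) : partialDer d x ∈ monoSpan P := by
  refine map_mem_of_mono (partialDer (K := K) (p := p) (S := S) d : DPRing K p S →ₗ[K] DPRing K p S) (fun ξ hξ => ?_) hx
  rw [Derivation.coeFn_coe]
  by_cases hb : ∀ a, ξ a < p ^ S a
  · rw [partialDer_mono d hb]
    split_ifs with h
    · exact Submodule.zero_mem _
    · exact mono_mem_monoSpan (hP ξ hξ h)
  · rw [mono_of_not hb, map_zero]
    exact Submodule.zero_mem _

theorem commute_partialDer (a b : ι) :
    Commute (partialDer (K := K) (p := p) (S := S) a : Module.End K (DPRing K p S))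
      (partialDer (K := K) (p := p) (S := S) b) := by
  refine lin_ext fun ξ hξ => ?_
  simp only [Module.End.mul_apply, Derivation.coeFn_coe]
  by_cases hab : a = b
  · rw [hab]
  rw [partialDer_mono a hξ, partialDer_mono b hξ]
  by_cases ha : ξ a = 0 <;> by_cases hb : ξ b = 0
  · simp [ha, hb]
  · rw [if_pos ha, if_neg hb, map_zero, partialDer_mono_eq_zero]
    simp [ha]
  · rw [if_pos hb, if_neg ha, map_zero, partialDer_mono_eq_zero]
    simp [hb]
  · rw [if_neg ha, if_neg hb, partialDer_mono _ (bound_sub hξ _),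
      partialDer_mono _ (bound_sub hξ _), if_neg, if_neg, tsub_right_comm]
    · simpa [Finsupp.single_eq_of_ne (Ne.symm hab), Finsupp.single_eq_of_ne hab] using hb
    · simpa [Finsupp.single_eq_of_ne (Ne.symm hab), Finsupp.single_eq_of_ne hab] using ha

theorem partialDer_pow_mono {a : ι} {m : ℕ} {ξ : ι →₀ ℕ} (hξ : ∀ a, ξ a < p ^ S a)
    (hm : ξ a < m) :
    ((partialDer (K := K) (p := p) (S := S) a : Module.End K (DPRing K p S)) ^ m) (mono ξ) = 0 := by
  induction m generalizing ξ with
  | zero => omega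
  | succ m ih =>
    rw [pow_succ, Module.End.mul_apply, Derivation.coeFn_coe, partialDer_mono a hξ]
    split_ifs with h
    · exact map_zero _
    · refine ih (bound_sub hξ a) ?_
      rw [Finsupp.tsub_apply, Finsupp.single_eq_same]
      omega

theorem partialDer_pow_eq_zero {a : ι} {s : ℕ} (hs : S a ≤ s) :
    (partialDer (K := K) (p := p) (S := S) a : Module.End K (DPRing K p S)) ^ p ^ s = 0 :=
  lin_ext fun _ hξ => partialDer_pow_mono hξ
    ((hξ a).trans_le (Nat.pow_le_pow_right (Fact.out : p.Prime).pos hs))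

end partialDer

/-! ### Degree filtration and nilpotency by contraction -/

section contraction

variable {K : Type*} [Field K] {ι : Type*} {p : ℕ} {S : ι → ℕ}

/-- The exponents in the variables in `T ∪ G` of degree at least `j` in the variables in `T`. -/
def expoDeg (T : Finset ι) (G : Set ι) (j : ℕ) : Set (ι →₀ ℕ) :=
  {ξ | ξ ∈ expoIn (T ∪ G) ∧ j ≤ ∑ a ∈ T, ξ a}

variable {T : Finset ι} {G : Set ι}

theorem add_mem_expoDeg {i j : ℕ} {ξ η : ι →₀ ℕ} (hξ : ξ ∈ expoDeg T G i)
    (hη : η ∈ expoDeg T G j) : ξ + η ∈ expoDeg T G (i + j) := by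
  refine ⟨add_mem_expoIn hξ.1 hη.1, ?_⟩
  simp only [Finsupp.add_apply, Finset.sum_add_distrib]
  exact add_le_add hξ.2 hη.2

theorem expoIn_subset_expoDeg : expoIn G ⊆ expoDeg T G 0 :=
  fun _ hξ => ⟨expoIn_mono Set.subset_union_right hξ, Nat.zero_le _⟩

theorem disjoint_expoDeg (hTG : ∀ a ∈ T, a ∉ G) : Disjoint (expoIn G) (expoDeg T G 1) := by
  refine Set.disjoint_left.mpr fun ξ h1 h2 => ?_
  have := h2.2
  rw [Finset.sum_eq_zero fun a ha => mem_expoIn_iff.mp h1 a (hTG a ha)] at this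
  omega

theorem expoDeg_anti {i j : ℕ} (h : i ≤ j) : expoDeg T G j ⊆ expoDeg T G i :=
  fun _ hξ => ⟨hξ.1, h.trans hξ.2⟩

/-- Exponents are truncated and `T` is finite, so the degree filtration terminates; this is what
turns raising the degree into nilpotency. -/
theorem monoSpan_expoDeg_eq_bot {j : ℕ} (hj : ∑ a ∈ T, p ^ S a < j) :
    (monoSpan (expoDeg T G j) : Submodule K (DPRing K p S)) = ⊥ := by
  refine le_bot_iff.mp (monoSpan_le fun ξ hξ => ?_)
  rw [Submodule.mem_bot, mono_of_not]
  intro h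
  have h1 : ∑ a ∈ T, ξ a ≤ ∑ a ∈ T, p ^ S a := Finset.sum_le_sum fun a _ => (h a).le
  have := hξ.2
  omega

variable [Fact p.Prime]

theorem mul_mem_expoDeg {i j : ℕ} {x y : DPRing K p S} (hx : x ∈ monoSpan (expoDeg T G i))
    (hy : y ∈ monoSpan (expoDeg T G j)) : x * y ∈ monoSpan (expoDeg T G (i + j)) :=
  mul_mem_monoSpan (fun _ hξ _ hη => add_mem_expoDeg hξ hη) hx hy

theorem expoDeg_factor {j : ℕ} {M : Submodule K (DPRing K p S)}
    (h : ∀ ξ ∈ expoIn (T : Set ι), j ≤ ∑ a ∈ T, ξ a → ∀ η ∈ expoIn G, mono ξ * mono η ∈ M) :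
    monoSpan (expoDeg T G j) ≤ M := by
  refine monoSpan_le fun ξ hξ => ?_
  by_cases hb : ∀ a, ξ a < p ^ S a
  · classical
    have e := mono_filter_mul (K := K) (T : Set ι) hb
    rw [← e]
    refine h _ (fun a ha => ?_) (hξ.2.trans (Finset.sum_congr rfl fun a ha => ?_).le) _
      (fun a ha => ?_)
    · rw [Finsupp.filter_apply] at ha
      simp only [ne_eq, ite_eq_right_iff, Classical.not_imp] at ha
      exact ha.1
    · rw [Finsupp.filter_apply, if_pos (by exact ha)]
    · rw [Finsupp.filter_apply] at ha
      simp only [ne_eq, ite_eq_right_iff, Classical.not_imp] at ha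
      exact (hξ.1 a ha.2).resolve_left ha.1
  · rw [mono_of_not hb]
    exact Submodule.zero_mem _

variable {w : Derivation K (DPRing K p S) (DPRing K p S)} {y : Module.End K (DPRing K p S)}

/-- If a derivation agrees with `y` on the subring in the variables `G`, modulo terms of positive
degree in further variables, then `y` satisfies the Leibniz rule on that subring. -/
theorem leibniz_of_sub_mem (hTG : ∀ a ∈ T, a ∉ G)
    (hy : ∀ f ∈ monoSpan (expoIn G), y f ∈ monoSpan (expoIn G))
    (hwy : ∀ f ∈ monoSpan (expoIn G), w f - y f ∈ monoSpan (expoDeg T G 1))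
    {f g : DPRing K p S} (hf : f ∈ monoSpan (expoIn G)) (hg : g ∈ monoSpan (expoIn G)) :
    y (f * g) = f * y g + g * y f := by
  have hfg := mul_mem_expoIn hf hg
  have hf' := monoSpan_mono (expoIn_subset_expoDeg (T := T)) hf
  have hg' := monoSpan_mono (expoIn_subset_expoDeg (T := T)) hg
  have h1 : y (f * g) - (f * y g + g * y f) ∈ monoSpan (expoIn G) :=
    Submodule.sub_mem _ (hy _ hfg)
      (Submodule.add_mem _ (mul_mem_expoIn hf (hy _ hg)) (mul_mem_expoIn hg (hy _ hf)))
  have h2 : y (f * g) - (f * y g + g * y f) ∈ monoSpan (expoDeg T G 1) := by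
    -- Since `w` is a derivation, the Leibniz defect of `y` is a combination of values of `w - y`,
    -- so it has positive degree in `T`. It also involves only variables in `G`, so it vanishes.
    have e : y (f * g) - (f * y g + g * y f) =
        f * (w g - y g) + g * (w f - y f) - (w (f * g) - y (f * g)) := by
      rw [Derivation.leibniz, smul_eq_mul, smul_eq_mul]
      ring
    rw [e]
    have h3 := mul_mem_expoDeg hf' (hwy g hg)
    have h4 := mul_mem_expoDeg hg' (hwy f hf)
    rw [zero_add] at h3 h4
    exact Submodule.sub_mem _ (Submodule.add_mem _ h3 h4) (hwy _ hfg)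
  exact sub_eq_zero.mp (eq_zero_of_mem_of_disjoint (disjoint_expoDeg hTG) h1 h2)

variable {W : Module.End K (DPRing K p S)}

theorem pow_mono_mul (hW : ∀ ξ ∈ expoIn (T : Set ι), ∀ x, W (mono ξ * x) = mono ξ * W x)
    {ξ : ι →₀ ℕ} (hξ : ξ ∈ expoIn (T : Set ι)) (i : ℕ) (x : DPRing K p S) :
    (W ^ i) (mono ξ * x) = mono ξ * (W ^ i) x := by
  induction i generalizing x with
  | zero => simp
  | succ i ih => rw [pow_succ, Module.End.mul_apply, hW ξ hξ, ih, Module.End.mul_apply]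

/-- By linearity over the variables in `T`, the gain in degree seen on the subring in `G` carries
over to every level of the filtration. -/
theorem map_expoDeg (hW : ∀ ξ ∈ expoIn (T : Set ι), ∀ x, W (mono ξ * x) = mono ξ * W x)
    {i : ℕ} (h : ∀ f ∈ monoSpan (expoIn G), W f ∈ monoSpan (expoDeg T G i)) (j : ℕ)
    {x : DPRing K p S} (hx : x ∈ monoSpan (expoDeg T G j)) :
    W x ∈ monoSpan (expoDeg T G (j + i)) := by
  refine expoDeg_factor (M := (monoSpan (expoDeg T G (j + i))).comap W) (fun ξ hξ hj η hη => ?_) hx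
  rw [Submodule.mem_comap, hW ξ hξ]
  exact mul_mem_expoDeg (mono_mem_monoSpan ⟨expoIn_mono Set.subset_union_left hξ, hj⟩)
    (h _ (mono_mem_monoSpan hη))

theorem pow_sub_pow_mem (hW : ∀ ξ ∈ expoIn (T : Set ι), ∀ x, W (mono ξ * x) = mono ξ * W x)
    (hy : ∀ f ∈ monoSpan (expoIn G), y f ∈ monoSpan (expoIn G))
    (hWy : ∀ f ∈ monoSpan (expoIn G), W f - y f ∈ monoSpan (expoDeg T G 1)) (i : ℕ) :
    ∀ f ∈ monoSpan (expoIn G), (y ^ i) f ∈ monoSpan (expoIn G) ∧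
      (W ^ i) f - (y ^ i) f ∈ monoSpan (expoDeg T G 1) := by
  have hW0 : ∀ f ∈ monoSpan (expoIn G), W f ∈ monoSpan (expoDeg T G 0) := fun f hf => by
    rw [← sub_add_cancel (W f) (y f)]
    exact Submodule.add_mem _ (monoSpan_mono (expoDeg_anti (Nat.zero_le 1)) (hWy f hf))
      (monoSpan_mono expoIn_subset_expoDeg (hy f hf))
  induction i with
  | zero => intro f hf; simpa using hf
  | succ i ih =>
    intro f hf
    obtain ⟨h1, h2⟩ := ih f hf
    rw [pow_succ', Module.End.mul_apply, pow_succ', Module.End.mul_apply,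
      ← sub_add_sub_cancel _ (W ((y ^ i) f)), ← map_sub]
    exact ⟨hy _ h1, Submodule.add_mem _ (map_expoDeg hW hW0 1 h2) (hWy _ h1)⟩

/-- A map that is linear over the variables in `T` and agrees with a nilpotent map on the subring in
the variables `G`, modulo terms of positive degree in `T`, is nilpotent on that subring. -/
theorem exists_pow_apply_eq_zero
    (hW : ∀ ξ ∈ expoIn (T : Set ι), ∀ x, W (mono ξ * x) = mono ξ * W x)
    (hy : ∀ f ∈ monoSpan (expoIn G), y f ∈ monoSpan (expoIn G))
    (hWy : ∀ f ∈ monoSpan (expoIn G), W f - y f ∈ monoSpan (expoDeg T G 1))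
    {N : ℕ} (hN : ∀ f ∈ monoSpan (expoIn G), (y ^ N) f = 0) :
    ∃ M : ℕ, ∀ f ∈ monoSpan (expoIn G), (W ^ M) f = 0 := by
  have h1 : ∀ f ∈ monoSpan (expoIn G), (W ^ N) f ∈ monoSpan (expoDeg T G 1) := fun f hf => by
    have := (pow_sub_pow_mem hW hy hWy N f hf).2
    rwa [hN f hf, sub_zero] at this
  -- Each block of `N` applications of `W` gains at least one degree in `T`, because `W ^ N` agrees
  -- with `y ^ N = 0` modulo degree one.
  have hiter : ∀ j, ∀ x ∈ monoSpan (expoDeg T G 0),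
      (W ^ (N * j)) x ∈ monoSpan (expoDeg T G j) := fun j => by
    induction j with
    | zero => intro x hx; simpa using hx
    | succ j ih =>
      intro x hx
      rw [Nat.mul_succ, add_comm (N * j), pow_add, Module.End.mul_apply]
      exact map_expoDeg (fun ξ hξ => pow_mono_mul hW hξ N) h1 j (ih x hx)
  refine ⟨N * (∑ a ∈ T, p ^ S a + 1), fun f hf => ?_⟩
  have := hiter (∑ a ∈ T, p ^ S a + 1) f (monoSpan_mono expoIn_subset_expoDeg hf)
  rwa [monoSpan_expoDeg_eq_bot (Nat.lt_succ_self _), Submodule.mem_bot] at this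

end contraction

end DPRing

/-! ### Iterates of the `p`-mapping as powers -/

section pMap

variable {K A : Type*} [Field K] [CommRing A] [Algebra K A] (p : ℕ) [Fact p.Prime] [CharP K p]

theorem coe_pMap (D : Derivation K A A) :
    ((pMap p D : Derivation K A A) : Module.End K A) = (D : Module.End K A) ^ p := rfl

theorem coe_pMap_iterate (D : Derivation K A A) (N : ℕ) :
    (((pMap p)^[N] D : Derivation K A A) : Module.End K A) = (D : Module.End K A) ^ p ^ N := by
  induction N with
  | zero => simp
  | succ N ih => rw [Function.iterate_succ_apply', coe_pMap, ih, ← pow_mul, pow_succ]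

theorem pMap_iterate_apply_eq_zero {D : Derivation K A A} {M N : ℕ} (h : M ≤ p ^ N) {x : A}
    (hx : ((D : Module.End K A) ^ M) x = 0) : (pMap p)^[N] D x = 0 := by
  rw [← Derivation.coeFn_coe, coe_pMap_iterate, ← Nat.sub_add_cancel h, pow_add,
    Module.End.mul_apply, hx, map_zero]

end pMap

end

noncomputable section

/-! ### Triangular action of the pivot elements on generations -/

namespace Specie

open DPRing

variable {k : ℕ} {Θ : Specie k} (K : Type*) [Field K] (p : ℕ) (S : Θ.Fly → ℕ)

variable (Θ) in
/-- The flies of generation at least `n`. -/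
def fliesFrom (n : ℕ) : Set Θ.Fly := {d | n ≤ d.1}

theorem fliesFrom_anti {m n : ℕ} (h : m ≤ n) : Θ.fliesFrom n ⊆ Θ.fliesFrom m :=
  fun _ hd => h.trans hd

theorem topPow_mem {V : Set Θ.Fly} {a : Θ.Fly} (ha : a ∈ V) :
    topPow K p S a ∈ monoSpan (expoIn V) :=
  mono_mem_monoSpan (single_mem_expoIn ha _)

variable [Fact p.Prime]

theorem pivotCoeffAux_mem (j : ℕ) {n : ℕ} (a : Θ.gen n) (d : Θ.Fly) :
    pivotCoeffAux K p S j a d ∈ monoSpan (expoIn (Θ.fliesFrom n)) := by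
  induction j generalizing n with
  | zero => exact Submodule.zero_mem _
  | succ j ih =>
    rw [pivotCoeffAux]
    refine Submodule.add_mem _ ?_ (mul_mem_expoIn (topPow_mem K p S (le_refl n))
      (Submodule.sum_mem _ fun b _ => ?_))
    · split_ifs
      · exact mono_mem_monoSpan (zero_mem_expoIn _)
      · exact Submodule.zero_mem _
    · split_ifs
      · exact mul_mem_expoIn (topPow_mem K p S (le_refl n))
          (monoSpan_mono (expoIn_mono (fliesFrom_anti n.le_succ)) (ih _))
      · exact Submodule.zero_mem _

theorem pivotCoeffAux_eq_zero (j : ℕ) {n : ℕ} (a : Θ.gen n) {d : Θ.Fly} (hd : d.1 < n) :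
    pivotCoeffAux K p S j a d = 0 := by
  induction j generalizing n with
  | zero => rfl
  | succ j ih =>
    have h1 : fly a ≠ d := by
      rintro rfl
      exact lt_irrefl _ hd
    rw [pivotCoeffAux, if_neg h1, zero_add, Finset.sum_eq_zero, mul_zero]
    intro b _
    split_ifs
    · rw [ih _ (hd.trans n.lt_succ_self), mul_zero]
    · rfl

variable [CharP K p]

theorem pivot_apply {n : ℕ} (a : Θ.gen n) (x : DPRing K p S) :
    pivot K p S a x = ∑ᶠ d, pivotCoeff K p S a d * partialDer d x := rfl

theorem pivot_mem {m n : ℕ} (hmn : m ≤ n) (a : Θ.gen n) {x : DPRing K p S}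
    (hx : x ∈ monoSpan (expoIn (Θ.fliesFrom m))) :
    pivot K p S a x ∈ monoSpan (expoIn (Θ.fliesFrom m)) := by
  rw [pivot_apply]
  refine finsum_induction (· ∈ monoSpan (expoIn (Θ.fliesFrom m))) (Submodule.zero_mem _)
    (fun _ _ => Submodule.add_mem _) fun d => ?_
  exact mul_mem_expoIn (monoSpan_mono (expoIn_mono (fliesFrom_anti hmn))
    (pivotCoeffAux_mem K p S _ a d))
    (partialDer_mem_monoSpan d (fun _ hξ _ => sub_mem_expoIn _ hξ) hx)

/-- The expansion of `v_a` contains only `∂_d` with `d` of generation at least `n`. -/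
theorem pivot_mono_eq_zero {n : ℕ} (a : Θ.gen n) {ξ : Θ.Fly →₀ ℕ}
    (hξ : ξ ∈ expoIn (Θ.fliesFrom n)ᶜ) : pivot K p S a (mono ξ) = 0 := by
  rw [pivot_apply]
  refine (finsum_congr fun d => ?_).trans finsum_zero
  by_cases hd : ξ d = 0
  · rw [partialDer_mono_eq_zero hd, mul_zero]
  · rw [pivotCoeff, pivotCoeffAux_eq_zero K p S _ a (not_le.mp (hξ d hd)), zero_mul]

open scoped Classical in
theorem pivot_apply_eq {n : ℕ} (a : Θ.gen n) (x : DPRing K p S) :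
    pivot K p S a x = partialDer (fly a) x + topPow K p S (fly a) * ∑ b : Θ.gen n,
      if h : a.1 ++ b.1 ∈ Θ.gen (n + 1) then topPow K p S (fly b) * pivot K p S (child h) x
      else 0 := by
  have hder : ∀ f : Θ.gen n → Derivation K (DPRing K p S) (DPRing K p S),
      (∑ b, f b) x = ∑ b, f b x := fun f => by
    have := congrFun (map_sum Derivation.coeFnAddMonoidHom f Finset.univ) x
    rwa [Finset.sum_apply] at this
  rw [pivot_eq, Derivation.add_apply, Derivation.smul_apply, smul_eq_mul, hder]
  congr 2
  refine Finset.sum_congr rfl fun b _ => ?_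
  split_ifs
  · rfl
  · rfl

/-- In the recursion, every term after `∂_a` ends in a pivot element of generation `n + 1`, which
kills these monomials. -/
theorem pivot_mono_of_le {n : ℕ} (a : Θ.gen n) {ξ : Θ.Fly →₀ ℕ}
    (hξ : ξ ∈ expoIn (Θ.fliesFrom (n + 1))ᶜ) :
    pivot K p S a (mono ξ) = partialDer (fly a) (mono ξ) := by
  rw [pivot_apply_eq, Finset.sum_eq_zero, mul_zero, add_zero]
  intro b _
  split_ifs
  · rw [pivot_mono_eq_zero K p S _ hξ, mul_zero]
  · rfl

theorem partialDer_eq_zero_of_mem {n : ℕ} (a : Θ.gen n) {x : DPRing K p S}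
    (hx : x ∈ monoSpan (expoIn (Θ.fliesFrom (n + 1)))) : partialDer (fly a) x = 0 := by
  simpa using eq_of_mono (P := expoIn (Θ.fliesFrom (n + 1)))
    (T := partialDer (K := K) (p := p) (S := S) (fly a)) (T' := 0)
    (fun _ hξ => partialDer_mono_eq_zero (mem_expoIn_iff.mp hξ _ (Nat.not_succ_le_self n))) hx

/-- The pivot element `v_a` as a linear map. -/
def pivotEnd {n : ℕ} (a : Θ.gen n) : Module.End K (DPRing K p S) := pivot K p S a

theorem pivotEnd_apply {n : ℕ} (a : Θ.gen n) (x : DPRing K p S) :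
    pivotEnd K p S a x = pivot K p S a x := rfl

/-! ### Words in the pivot elements of one generation -/

/-- The span of the products of at least one and at most `D` pivot elements of generation `n` in
the associative algebra of linear maps. -/
def pivotWords (D n : ℕ) : Submodule K (Module.End K (DPRing K p S)) :=
  Submodule.span K {T | ∃ l : List (Θ.gen n), l ≠ [] ∧ l.length ≤ D ∧
    T = (l.map (pivotEnd K p S)).prod}

variable {K p S}

theorem pivotWords_mono {D E n : ℕ} (h : D ≤ E) : pivotWords K p S D n ≤ pivotWords K p S E n :=
  Submodule.span_mono fun _ ⟨l, h1, h2, h3⟩ => ⟨l, h1, h2.trans h, h3⟩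

theorem pivotWords_zero (n : ℕ) : pivotWords K p S 0 n = ⊥ := by
  refine Submodule.span_eq_bot.mpr ?_
  rintro T ⟨l, h1, h2, -⟩
  exact (h1 (List.length_eq_zero_iff.mp (Nat.le_zero.mp h2))).elim

theorem pivotEnd_mem {n : ℕ} (a : Θ.gen n) : pivotEnd K p S a ∈ pivotWords K p S 1 n :=
  Submodule.subset_span ⟨[a], by simp, by simp, by simp⟩

theorem mul_mem_pivotWords {D E n : ℕ} {T U : Module.End K (DPRing K p S)}
    (hT : T ∈ pivotWords K p S D n) (hU : U ∈ pivotWords K p S E n) :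
    T * U ∈ pivotWords K p S (D + E) n := by
  have h : pivotWords K p S D n * pivotWords K p S E n ≤ pivotWords K p S (D + E) n := by
    rw [pivotWords, pivotWords, Submodule.span_mul_span]
    refine Submodule.span_mono ?_
    rintro _ ⟨_, ⟨l, h1, h2, rfl⟩, _, ⟨l', h1', h2', rfl⟩, rfl⟩
    refine ⟨l ++ l', by simp [h1], ?_, by simp⟩
    rw [List.length_append]
    exact add_le_add h2 h2'
  exact h (Submodule.mul_mem_mul hT hU)

theorem pow_mem_pivotWords {D n : ℕ} {T : Module.End K (DPRing K p S)}
    (hT : T ∈ pivotWords K p S D n) {m : ℕ} (hm : 0 < m) :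
    T ^ m ∈ pivotWords K p S (m * D) n := by
  induction m, hm using Nat.le_induction with
  | base => simpa using hT
  | succ m _ ih =>
    rw [pow_succ, Nat.succ_mul]
    exact mul_mem_pivotWords ih hT

/-- Induction principle for words, by adding factors on the left. It starts at length one because
the empty word is excluded; thus the span for `D = 0` is zero and all words kill the earlier
variables. -/
theorem pivotWords_le {n : ℕ} {M : ℕ → Submodule K (Module.End K (DPRing K p S))} (hM : Monotone M)
    (h1 : ∀ a : Θ.gen n, pivotEnd K p S a ∈ M 1)
    (hmul : ∀ D, ∀ a : Θ.gen n, ∀ T ∈ M D, pivotEnd K p S a * T ∈ M (D + 1)) (D : ℕ) :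
    pivotWords K p S D n ≤ M D := by
  have key : ∀ l : List (Θ.gen n), l ≠ [] → (l.map (pivotEnd K p S)).prod ∈ M l.length := by
    intro l
    induction l with
    | nil => exact fun h => (h rfl).elim
    | cons a l ih =>
      intro _
      rw [List.map_cons, List.prod_cons, List.length_cons]
      rcases eq_or_ne l [] with rfl | hl
      · simpa using h1 a
      · exact hmul _ a _ (ih hl)
  refine Submodule.span_le.mpr ?_
  rintro _ ⟨l, hl, hD, rfl⟩
  exact hM hD (key l hl)

theorem pivotWords_map_mem {D n : ℕ} {T : Module.End K (DPRing K p S)}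
    (hT : T ∈ pivotWords K p S D n) {x : DPRing K p S}
    (hx : x ∈ monoSpan (expoIn (Θ.fliesFrom n))) : T x ∈ monoSpan (expoIn (Θ.fliesFrom n)) := by
  let M : Submodule K (Module.End K (DPRing K p S)) :=
    { carrier := {T | ∀ x ∈ monoSpan (expoIn (Θ.fliesFrom n)),
        T x ∈ monoSpan (expoIn (Θ.fliesFrom n))}
      add_mem' := fun hT hU x hx => Submodule.add_mem _ (hT x hx) (hU x hx)
      zero_mem' := fun x _ => Submodule.zero_mem _
      smul_mem' := fun c T hT x hx => Submodule.smul_mem _ c (hT x hx) }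
  exact pivotWords_le (M := fun _ => M) monotone_const
    (fun a x hx => pivot_mem K p S le_rfl a hx)
    (fun _ a T hT x hx => pivot_mem K p S le_rfl a (hT x hx)) D hT x hx

theorem pivotWords_mono_mul {D n : ℕ} {T : Module.End K (DPRing K p S)}
    (hT : T ∈ pivotWords K p S D n) {ξ : Θ.Fly →₀ ℕ} (hξ : ξ ∈ expoIn (Θ.fliesFrom n)ᶜ)
    (x : DPRing K p S) : T (mono ξ * x) = mono ξ * T x := by
  let M : Submodule K (Module.End K (DPRing K p S)) :=
    { carrier := {T | ∀ x, T (mono ξ * x) = mono ξ * T x}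
      add_mem' := fun {T U} hT hU x => by
        rw [LinearMap.add_apply, hT x, hU x, LinearMap.add_apply, mul_add]
      zero_mem' := fun x => by simp
      smul_mem' := fun c T hT x => by
        rw [LinearMap.smul_apply, hT x, LinearMap.smul_apply, mul_smul_comm] }
  have hp : ∀ (a : Θ.gen n) x, pivotEnd K p S a (mono ξ * x) = mono ξ * pivotEnd K p S a x :=
    fun a x => by
      simp only [pivotEnd_apply]
      rw [Derivation.leibniz, pivot_mono_eq_zero K p S a hξ, smul_zero, add_zero, smul_eq_mul]
  refine pivotWords_le (M := fun _ => M) monotone_const hp (fun _ a T hT x => ?_) D hT x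
  rw [Module.End.mul_apply, hT, hp, Module.End.mul_apply]

theorem pivotWords_mono_eq_zero {D n : ℕ} {T : Module.End K (DPRing K p S)}
    (hT : T ∈ pivotWords K p S D n) {ξ : Θ.Fly →₀ ℕ} (hξ : ξ ∈ expoIn (Θ.fliesFrom n)ᶜ) :
    T (mono ξ) = 0 := by
  let M : Submodule K (Module.End K (DPRing K p S)) := LinearMap.ker (LinearMap.applyₗ (mono ξ))
  refine pivotWords_le (M := fun _ => M) monotone_const
    (fun a => pivot_mono_eq_zero K p S a hξ) (fun _ a T hT => ?_) D hT
  change pivotEnd K p S a (T (mono ξ)) = 0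
  rw [show T (mono ξ) = 0 from hT, map_zero]

/-- On the monomials in variables `t_d` with `S d ≤ s` in generation `n`, the pivot elements of that
generation act as commuting partial derivatives. -/
theorem pivotWords_pow_mono_eq_zero {D n s : ℕ} {T : Module.End K (DPRing K p S)}
    (hT : T ∈ pivotWords K p S D n) {V : Set Θ.Fly} (hV : ∀ d ∈ V, d.1 = n ∧ S d ≤ s)
    {ξ : Θ.Fly →₀ ℕ} (hξ : ξ ∈ expoIn V) : (T ^ p ^ s) (mono ξ) = 0 := by
  classical
  have hp : p ^ s ≠ 0 := pow_ne_zero _ (Fact.out : p.Prime).ne_zero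
  -- In this commutative algebra the `p^s`-power map is additive, so elements with vanishing
  -- `p^s`-th power are closed under sums. `M` collects the maps that agree with such an element on
  -- the subring in `V`.
  let C : Subalgebra K (Module.End K (DPRing K p S)) := Algebra.adjoin K
    (Set.range fun d : Θ.Fly => (partialDer (K := K) (p := p) (S := S) d :
      Module.End K (DPRing K p S)))
  have hC : ∀ q ∈ C, ∀ q' ∈ C, Commute q q' := fun q hq q' hq' => by
    refine Algebra.commute_of_mem_adjoin_of_forall_mem_commute hq' ?_
    rintro _ ⟨d, rfl⟩
    refine (Algebra.commute_of_mem_adjoin_of_forall_mem_commute hq ?_).symm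
    rintro _ ⟨e, rfl⟩
    exact commute_partialDer d e
  let M : Submodule K (Module.End K (DPRing K p S)) :=
    { carrier := {T | ∃ q ∈ C, q ^ p ^ s = 0 ∧ ∀ x ∈ monoSpan (expoIn V),
        T x = q x ∧ q x ∈ monoSpan (expoIn V)}
      add_mem' := by
        rintro T U ⟨q, hq, h1, h2⟩ ⟨q', hq', h1', h2'⟩
        refine ⟨q + q', add_mem hq hq', ?_, fun x hx => ⟨?_, ?_⟩⟩
        · rw [add_pow_char_pow_of_commute p s (hC q hq q' hq'), h1, h1', add_zero]
        · rw [LinearMap.add_apply, (h2 x hx).1, (h2' x hx).1, LinearMap.add_apply]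
        · exact Submodule.add_mem _ (h2 x hx).2 (h2' x hx).2
      zero_mem' := ⟨0, zero_mem _, zero_pow hp, fun x _ => ⟨rfl, Submodule.zero_mem _⟩⟩
      smul_mem' := by
        rintro c T ⟨q, hq, h1, h2⟩
        refine ⟨c • q, Subalgebra.smul_mem _ hq c, ?_, fun x hx => ⟨?_, ?_⟩⟩
        · rw [smul_pow, h1, smul_zero]
        · rw [LinearMap.smul_apply, (h2 x hx).1, LinearMap.smul_apply]
        · exact Submodule.smul_mem _ c (h2 x hx).2 }
  have hVn : V ⊆ (Θ.fliesFrom (n + 1))ᶜ := fun d hd h => by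
    have h1 := (hV d hd).1
    have h2 : n + 1 ≤ d.1 := h
    omega
  have hpiv : ∀ a : Θ.gen n, pivotEnd K p S a ∈ M := fun a => by
    have hx : ∀ x ∈ monoSpan (expoIn V), pivotEnd K p S a x = partialDer (fly a) x :=
      fun x hx => eq_of_mono (T := pivotEnd K p S a)
        (T' := partialDer (K := K) (p := p) (S := S) (fly a))
        (fun ξ hξ => pivot_mono_of_le K p S a (expoIn_mono hVn hξ)) hx
    by_cases ha : fly a ∈ V
    · exact ⟨_, Algebra.subset_adjoin ⟨fly a, rfl⟩, partialDer_pow_eq_zero (hV _ ha).2,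
        fun x h => ⟨hx x h, partialDer_mem_monoSpan _ (fun _ hξ _ => sub_mem_expoIn _ hξ) h⟩⟩
    -- If `t_a` is not among the variables in `V`, then `∂_a`, and with it `v_a`, acts there as
    -- zero.
    · refine ⟨0, zero_mem _, zero_pow hp, fun x h => ⟨?_, Submodule.zero_mem _⟩⟩
      rw [hx x h]
      exact eq_of_mono (T := partialDer (K := K) (p := p) (S := S) (fly a)) (T' := 0)
        (fun ξ hξ => partialDer_mono_eq_zero (mem_expoIn_iff.mp hξ _ ha)) h
  obtain ⟨q, -, hq, hTq⟩ := pivotWords_le (M := fun _ => M) monotone_const hpiv (by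
    rintro _ a T ⟨q', hq', -, h2'⟩
    obtain ⟨q, hq, h1, h2⟩ := hpiv a
    refine ⟨q * q', mul_mem hq hq', ?_, fun x hx => ⟨?_, ?_⟩⟩
    · rw [(hC q hq q' hq').mul_pow, h1, zero_mul]
    · rw [Module.End.mul_apply, (h2' x hx).1, (h2 _ (h2' x hx).2).1, Module.End.mul_apply]
    · exact (h2 _ (h2' x hx).2).2) D hT
  have hpow : ∀ i, ∀ x ∈ monoSpan (expoIn V),
      (T ^ i) x = (q ^ i) x ∧ (q ^ i) x ∈ monoSpan (expoIn V) := fun i => by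
    induction i with
    | zero => intro x hx; simpa using hx
    | succ i ih =>
      intro x hx
      obtain ⟨h1, h2⟩ := ih x hx
      rw [pow_succ', Module.End.mul_apply, h1, (hTq _ h2).1, pow_succ', Module.End.mul_apply]
      exact ⟨rfl, (hTq _ h2).2⟩
  rw [(hpow _ _ (mono_mem_monoSpan hξ)).1, hq, LinearMap.zero_apply]

end Specie

end

noncomputable section

namespace Specie

/-! ### Weights: passing from generation `n` to `n + 1` -/

open DPRing

variable {k : ℕ} {Θ : Specie k} {K : Type*} [Field K] {p : ℕ} {S : Θ.Fly → ℕ} [Fact p.Prime]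
  [CharP K p]

open scoped Classical in
/-- The flies `a` of generation `n` with `S a ≤ s`. -/
def fliesBelow (S : Θ.Fly → ℕ) (n s : ℕ) : Finset Θ.Fly :=
  (Finset.univ.image fun a : Θ.gen n => fly a).filter fun d => S d ≤ s

theorem mem_fliesBelow {n s : ℕ} {d : Θ.Fly} : d ∈ fliesBelow S n s ↔ d.1 = n ∧ S d ≤ s := by
  simp only [fliesBelow, Finset.mem_filter, Finset.mem_image, Finset.mem_univ, true_and]
  refine and_congr_left fun _ => ⟨?_, ?_⟩
  · rintro ⟨a, rfl⟩
    rfl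
  · rintro rfl
    exact ⟨d.2, rfl⟩

variable (K p S) in
/-- The span of the maps `x ↦ t^(ξ) * y x`, where `ξ` involves variables `t_a` with `S a ≤ s` of
generation `n`, and `y` is a product of `E` pivot elements of generation `n + 1`, of total weight
`lam * E - ∑ ξ ≤ D`. -/
def weightSpan (n s lam D : ℕ) : Submodule K (Module.End K (DPRing K p S)) :=
  Submodule.span K {m | ∃ ξ ∈ expoIn (fliesBelow S n s : Set Θ.Fly), ∃ E,
    ∃ y ∈ pivotWords K p S E (n + 1), lam * E ≤ D + ∑ d ∈ fliesBelow S n s, ξ d ∧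
      m = LinearMap.mulLeft K (mono ξ) * y}

theorem mem_weightSpan {n s lam D : ℕ} {ξ : Θ.Fly →₀ ℕ}
    (hξ : ξ ∈ expoIn (fliesBelow S n s : Set Θ.Fly)) {E : ℕ}
    {y : Module.End K (DPRing K p S)} (hy : y ∈ pivotWords K p S E (n + 1))
    (h : lam * E ≤ D + ∑ d ∈ fliesBelow S n s, ξ d) :
    LinearMap.mulLeft K (mono ξ) * y ∈ weightSpan K p S n s lam D :=
  Submodule.subset_span ⟨ξ, hξ, E, y, hy, h, rfl⟩

theorem weightSpan_mono {n s lam : ℕ} : Monotone (weightSpan K p S n s lam) :=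
  fun _ _ h => Submodule.span_mono fun _ ⟨ξ, hξ, E, y, hy, hE, e⟩ =>
    ⟨ξ, hξ, E, y, hy, hE.trans (Nat.add_le_add_right h _), e⟩

/-- The case where `v_a` passes `t^ξ` and hits later variables: `∂_a` vanishes, and each child `ab`
costs `lam` for the new factor but returns `lam - 1` in degree. Only the words `v_c z` are required,
so `z = 1` with `E = 0` is allowed although the identity is not a nonempty word. -/
theorem exists_weightSpan_of_child {n s lam : ℕ}
    (hc : ∀ a b : Θ.gen n, a.1 ++ b.1 ∈ Θ.gen (n + 1) →
      S (fly a) ≤ s ∧ S (fly b) ≤ s ∧ p ^ S (fly a) + p ^ S (fly b) = lam + 1)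
    {D E : ℕ} {ξ : Θ.Fly →₀ ℕ} (hξ : ξ ∈ expoIn (fliesBelow S n s : Set Θ.Fly))
    {z : Module.End K (DPRing K p S)}
    (hz : ∀ c : Θ.gen (n + 1), pivotEnd K p S c * z ∈ pivotWords K p S (E + 1) (n + 1))
    (hE : lam * E ≤ D + ∑ d ∈ fliesBelow S n s, ξ d) (a : Θ.gen n) :
    ∃ m ∈ weightSpan K p S n s lam (D + 1), ∀ x, z x ∈ monoSpan (expoIn (Θ.fliesFrom (n + 1))) →
      mono ξ * pivot K p S a (z x) = m x := by
  classical
  refine ⟨∑ b : Θ.gen n, if h : a.1 ++ b.1 ∈ Θ.gen (n + 1) then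
      LinearMap.mulLeft K (mono ξ * (topPow K p S (fly a) * topPow K p S (fly b))) *
        (pivotEnd K p S (child h) * z) else 0, ?_, fun x hx => ?_⟩
  · refine Submodule.sum_mem _ fun b _ => ?_
    split_ifs with h
    · obtain ⟨ha, hb, hab⟩ := hc a b h
      have hma : fly a ∈ fliesBelow S n s := mem_fliesBelow.mpr ⟨rfl, ha⟩
      have hmb : fly b ∈ fliesBelow S n s := mem_fliesBelow.mpr ⟨rfl, hb⟩
      obtain ⟨c, hc⟩ := exists_mono_mul (K := K) (p := p) (S := S)
        (Finsupp.single (fly a) (p ^ S (fly a) - 1)) (Finsupp.single (fly b) (p ^ S (fly b) - 1))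
      obtain ⟨c', hc'⟩ := exists_mono_mul (K := K) (p := p) (S := S) ξ
        (Finsupp.single (fly a) (p ^ S (fly a) - 1) + Finsupp.single (fly b) (p ^ S (fly b) - 1))
      have e : LinearMap.mulLeft K (mono ξ * (topPow K p S (fly a) * topPow K p S (fly b))) *
          (pivotEnd K p S (child h) * z) = c • c' • (LinearMap.mulLeft K (mono (ξ +
            (Finsupp.single (fly a) (p ^ S (fly a) - 1) +
              Finsupp.single (fly b) (p ^ S (fly b) - 1)))) *
          (pivotEnd K p S (child h) * z)) := by
        ext x
        simp only [Module.End.mul_apply, LinearMap.mulLeft_apply, LinearMap.smul_apply]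
        rw [topPow, topPow, hc, mul_smul_comm, hc', smul_mul_assoc, smul_mul_assoc]
      rw [e]
      refine Submodule.smul_mem _ _ (Submodule.smul_mem _ _ (mem_weightSpan
        (add_mem_expoIn hξ (add_mem_expoIn (single_mem_expoIn hma _) (single_mem_expoIn hmb _)))
        (hz _) ?_))
      have h1 : ∀ d ∈ fliesBelow S n s, ∀ m : ℕ,
          ∑ e ∈ fliesBelow S n s, Finsupp.single d m e = m := fun d hd m => by
        simp [Finsupp.single_apply, hd]
      -- The two maximal powers add `(p^(S_a) - 1) + (p^(S_b) - 1) = lam - 1` to the degree, against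
      -- `lam` on the left: a net cost of 1.
      simp only [Finsupp.add_apply, Finset.sum_add_distrib]
      rw [h1 _ hma, h1 _ hmb, Nat.mul_succ]
      have h2 : 0 < p ^ S (fly a) := pow_pos (Fact.out : p.Prime).pos _
      have h3 : 0 < p ^ S (fly b) := pow_pos (Fact.out : p.Prime).pos _
      omega
    · exact Submodule.zero_mem _
  · rw [pivot_apply_eq, partialDer_eq_zero_of_mem K p S a hx, zero_add, LinearMap.sum_apply,
      Finset.mul_sum, Finset.mul_sum]
    refine Finset.sum_congr rfl fun b _ => ?_
    split_ifs with h
    · rw [Module.End.mul_apply, Module.End.mul_apply, LinearMap.mulLeft_apply, pivotEnd_apply]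
      ring
    · simp

variable (K p S) in
/-- The maps that agree with an element of `weightSpan` on the variables of generation `> n`. -/
def weightRestrict (n s lam D : ℕ) : Submodule K (Module.End K (DPRing K p S)) where
  carrier := {T | ∃ m ∈ weightSpan K p S n s lam D,
    ∀ x ∈ monoSpan (expoIn (Θ.fliesFrom (n + 1))), T x = m x}
  add_mem' := by
    rintro T U ⟨m, hm, h⟩ ⟨m', hm', h'⟩
    exact ⟨m + m', Submodule.add_mem _ hm hm', fun x hx => by
      rw [LinearMap.add_apply, h x hx, h' x hx, LinearMap.add_apply]⟩
  zero_mem' := ⟨0, Submodule.zero_mem _, fun _ _ => rfl⟩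
  smul_mem' := by
    rintro c T ⟨m, hm, h⟩
    exact ⟨c • m, Submodule.smul_mem _ c hm, fun x hx => by
      rw [LinearMap.smul_apply, h x hx, LinearMap.smul_apply]⟩

/-- The case where `v_a` differentiates the coefficient: the degree drops by at most one, so the
weight grows by at most one. -/
theorem exists_weightSpan_partialDer {n s lam D E : ℕ} {ξ : Θ.Fly →₀ ℕ}
    (hξ : ξ ∈ expoIn (fliesBelow S n s : Set Θ.Fly))
    {y : Module.End K (DPRing K p S)} (hy : y ∈ pivotWords K p S E (n + 1))
    (hE : lam * E ≤ D + ∑ d ∈ fliesBelow S n s, ξ d) (a : Θ.Fly) :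
    ∃ m ∈ weightSpan K p S n s lam (D + 1), ∀ x,
      partialDer (K := K) (p := p) (S := S) a (mono ξ) * y x = m x := by
  by_cases hb : ∀ d, ξ d < p ^ S d
  · rw [partialDer_mono _ hb]
    split_ifs with h0
    · exact ⟨0, Submodule.zero_mem _, fun x => by rw [zero_mul, LinearMap.zero_apply]⟩
    · refine ⟨_, mem_weightSpan (sub_mem_expoIn (Finsupp.single a 1) hξ) hy ?_, fun x => rfl⟩
      classical
      have h1 : ∑ d ∈ fliesBelow S n s, ξ d ≤
          ∑ d ∈ fliesBelow S n s, (ξ - Finsupp.single a 1 : Θ.Fly →₀ ℕ) d +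
            ∑ d ∈ fliesBelow S n s, (Finsupp.single a 1 : Θ.Fly →₀ ℕ) d := by
        rw [← Finset.sum_add_distrib]
        exact Finset.sum_le_sum fun d _ => le_tsub_add
      have h2 : ∑ d ∈ fliesBelow S n s, (Finsupp.single a 1 : Θ.Fly →₀ ℕ) d ≤ 1 := by
        simp only [Finsupp.single_apply, Finset.sum_ite_eq]
        split_ifs <;> simp
      omega
  · refine ⟨0, Submodule.zero_mem _, fun x => ?_⟩
    rw [mono_of_not hb, map_zero, zero_mul, LinearMap.zero_apply]

theorem pivotEnd_mul_mem_weightRestrict {n s lam : ℕ}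
    (hc : ∀ a b : Θ.gen n, a.1 ++ b.1 ∈ Θ.gen (n + 1) →
      S (fly a) ≤ s ∧ S (fly b) ≤ s ∧ p ^ S (fly a) + p ^ S (fly b) = lam + 1)
    {D : ℕ} (a : Θ.gen n) {m : Module.End K (DPRing K p S)}
    (hm : m ∈ weightSpan K p S n s lam D) :
    pivotEnd K p S a * m ∈ weightRestrict K p S n s lam (D + 1) := by
  have hle : weightSpan K p S n s lam D ≤ (weightRestrict K p S n s lam (D + 1)).comap
      (LinearMap.mulLeft K (pivotEnd K p S a)) := by
    refine Submodule.span_le.mpr ?_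
    rintro _ ⟨ξ, hξ, E, y, hy, hE, rfl⟩
    obtain ⟨m', hm', h⟩ := exists_weightSpan_of_child hc hξ (z := y) (fun c => by
      rw [add_comm]; exact mul_mem_pivotWords (pivotEnd_mem c) hy) hE a
    have hξn : ξ ∈ expoIn (Θ.fliesFrom (n + 1))ᶜ := expoIn_mono (fun d hd h => by
      have h1 := (mem_fliesBelow.mp hd).1
      have h2 : n + 1 ≤ d.1 := h
      omega) hξ
    obtain ⟨m'', hm'', h''⟩ := exists_weightSpan_partialDer hξ hy hE (fly a)
    -- The two summands are the two terms of the Leibniz rule for `v_a (t^ξ * y x)`.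
    refine ⟨m' + m'', Submodule.add_mem _ hm' hm'', fun x hx => ?_⟩
    rw [LinearMap.add_apply, ← h x (pivotWords_map_mem hy hx), ← h'' x, LinearMap.mulLeft_apply,
      Module.End.mul_apply, Module.End.mul_apply, LinearMap.mulLeft_apply, pivotEnd_apply,
      Derivation.leibniz, pivot_mono_of_le K p S a hξn, smul_eq_mul, smul_eq_mul, mul_comm (y x)]
  exact hle hm

/-- Products of pivot elements of generation `n`, restricted to the variables of the later
generations. -/
theorem pivotWords_le_weightRestrict {n s lam : ℕ}
    (hc : ∀ a b : Θ.gen n, a.1 ++ b.1 ∈ Θ.gen (n + 1) →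
      S (fly a) ≤ s ∧ S (fly b) ≤ s ∧ p ^ S (fly a) + p ^ S (fly b) = lam + 1) (D : ℕ) :
    pivotWords K p S D n ≤ weightRestrict K p S n s lam D := by
  refine pivotWords_le (fun D E h => ?_) (fun a => ?_) ?_ D
  · rintro T ⟨m, hm, h'⟩
    exact ⟨m, weightSpan_mono h hm, h'⟩
  · obtain ⟨m, hm, h⟩ := exists_weightSpan_of_child (K := K) hc (D := 0) (E := 0) (ξ := 0)
      (z := 1) (zero_mem_expoIn _) (fun c => by simpa using pivotEnd_mem c) (by simp) a
    refine ⟨m, hm, fun x hx => ?_⟩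
    rw [← h x hx, mono_zero, one_mul]
    rfl
  · rintro D a T ⟨m, hm, hTm⟩
    obtain ⟨m', hm', h⟩ := pivotEnd_mul_mem_weightRestrict hc a hm
    refine ⟨m', hm', fun x hx => ?_⟩
    rw [Module.End.mul_apply, hTm x hx, ← h x hx, Module.End.mul_apply]

/-- Terms with `ξ ≠ 0` land in positive degree. Those with `ξ = 0` satisfy `lam * E ≤ D`, and their
sum is `y`. -/
theorem exists_sub_mem_of_mem_weightSpan {n s lam : ℕ} (hlam : 0 < lam) {D : ℕ}
    {m : Module.End K (DPRing K p S)} (hm : m ∈ weightSpan K p S n s lam D) :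
    ∃ y ∈ pivotWords K p S (D / lam) (n + 1), ∀ x ∈ monoSpan (expoIn (Θ.fliesFrom (n + 1))),
      m x - y x ∈ monoSpan (expoDeg (fliesBelow S n s) (Θ.fliesFrom (n + 1)) 1) := by
  refine Submodule.span_induction ?_ ?_ ?_ ?_ hm
  · rintro _ ⟨ξ, hξ, E, y, hy, hE, rfl⟩
    by_cases h0 : ∑ d ∈ fliesBelow S n s, ξ d = 0
    · have hξ0 : ξ = 0 := by
        ext d
        by_cases hd : d ∈ fliesBelow S n s
        · exact Finset.sum_eq_zero_iff.mp h0 d hd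
        · exact mem_expoIn_iff.mp hξ d hd
      refine ⟨y, pivotWords_mono ?_ hy, fun x _ => ?_⟩
      · rw [Nat.le_div_iff_mul_le hlam, mul_comm]
        omega
      · rw [hξ0, Module.End.mul_apply, LinearMap.mulLeft_apply, mono_zero, one_mul, sub_self]
        exact Submodule.zero_mem _
    · refine ⟨0, Submodule.zero_mem _, fun x hx => ?_⟩
      rw [LinearMap.zero_apply, sub_zero]
      exact mul_mem_expoDeg (i := 1) (j := 0) (mono_mem_monoSpan
        ⟨expoIn_mono Set.subset_union_left hξ, Nat.one_le_iff_ne_zero.mpr h0⟩)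
        (monoSpan_mono expoIn_subset_expoDeg (pivotWords_map_mem hy hx))
  · exact ⟨0, Submodule.zero_mem _, fun x _ => by simp⟩
  · rintro m m' _ _ ⟨y, hy, h⟩ ⟨y', hy', h'⟩
    refine ⟨y + y', Submodule.add_mem _ hy hy', fun x hx => ?_⟩
    rw [LinearMap.add_apply, LinearMap.add_apply, add_sub_add_comm]
    exact Submodule.add_mem _ (h x hx) (h' x hx)
  · rintro c m _ ⟨y, hy, h⟩
    refine ⟨c • y, Submodule.smul_mem _ c hy, fun x hx => ?_⟩
    rw [LinearMap.smul_apply, LinearMap.smul_apply, ← smul_sub]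
    exact Submodule.smul_mem _ c (h x hx)

theorem exists_weight {n : ℕ} (hS : ∀ a, 1 ≤ S a) (hunif : IsUniform S) :
    ∃ s lam, p ^ s < lam ∧ ∀ a b : Θ.gen n, a.1 ++ b.1 ∈ Θ.gen (n + 1) →
      S (fly a) ≤ s ∧ S (fly b) ≤ s ∧ p ^ S (fly a) + p ^ S (fly b) = lam + 1 := by
  obtain ⟨s, r, h⟩ := hunif
  have hp := (Fact.out : p.Prime).one_lt
  -- An actual fly of generation `n + 1` shows that `s_n` and `r_n` are values of `S`, hence
  -- positive.
  obtain ⟨w, hw⟩ : (Θ.gen (n + 1)).Nonempty := by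
    rw [← Finset.card_pos]
    have := Θ.three_le (n + 1)
    omega
  obtain ⟨a, ha, b, hb, -, rfl⟩ := Θ.gen_succ n w hw
  have hsr : 1 ≤ s n ∧ 1 ≤ r n := by
    have h1 := hS (fly (⟨a, ha⟩ : Θ.gen n))
    have h2 := hS (fly (⟨b, hb⟩ : Θ.gen n))
    rcases h n ⟨a, ha⟩ ⟨b, hb⟩ hw with ⟨e1, e2⟩ | ⟨e1, e2⟩ <;> omega
  have hs : 1 < p ^ s n := Nat.one_lt_pow (by omega) hp
  have hr : 1 < p ^ r n := Nat.one_lt_pow (by omega) hp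
  -- The strict inequality `p^s < lam` holds because the smaller of the two powers is at least 2.
  refine ⟨max (s n) (r n), p ^ s n + p ^ r n - 1, ?_, fun a b hab => ?_⟩
  · rcases max_choice (s n) (r n) with e | e <;> rw [e] <;> omega
  · rcases h n a b hab with ⟨e1, e2⟩ | ⟨e1, e2⟩
    · rw [e1, e2]
      exact ⟨le_max_left _ _, le_max_right _ _, by omega⟩
    · rw [e1, e2]
      exact ⟨le_max_right _ _, le_max_left _ _, by omega⟩

/-! ### The induction on word length -/

/-- Each derivation in the associative algebra generated by the pivot elements of generation `n`
is nil. -/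
theorem pMap_iterate_eq_zero (hS : ∀ a, 1 ≤ S a) (hunif : IsUniform S) (D : ℕ) :
    ∀ (n : ℕ) (w : Derivation K (DPRing K p S) (DPRing K p S)),
      (w : Module.End K (DPRing K p S)) ∈ pivotWords K p S D n → ∃ N : ℕ, (pMap p)^[N] w = 0 := by
  induction D using Nat.strong_induction_on with
  | _ D ih =>
  intro n w hw
  rcases Nat.eq_zero_or_pos D with rfl | hD
  · rw [pivotWords_zero, Submodule.mem_bot] at hw
    exact ⟨0, derivation_eq_zero fun ξ => LinearMap.congr_fun hw (mono ξ)⟩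
  have hp := (Fact.out : p.Prime)
  obtain ⟨s, lam, hlt, hc⟩ := exists_weight (p := p) (n := n) hS hunif
  have hlam : 0 < lam := (Nat.zero_le _).trans_lt hlt
  obtain ⟨W, hW⟩ : ∃ W : Module.End K (DPRing K p S), W = w := ⟨_, rfl⟩
  rw [← hW] at hw
  -- The exponent `p^s` is large enough to kill every generation `n` variable that can occur in a
  -- coefficient, yet below `lam`, so that the next words are shorter.
  have hWs := pow_mem_pivotWords hw (pow_pos hp.pos s)
  obtain ⟨w', hw'⟩ : ∃ w' : Derivation K (DPRing K p S) (DPRing K p S),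
      (w' : Module.End K (DPRing K p S)) = W ^ p ^ s :=
    ⟨(pMap p)^[s] w, by rw [coe_pMap_iterate, hW]⟩
  have hw'a : ∀ x, w' x = (W ^ p ^ s) x := fun x => by rw [← hw']; rfl
  have hTG : ∀ d ∈ fliesBelow S n s, d ∉ Θ.fliesFrom (n + 1) := fun d hd h => by
    have h1 := (mem_fliesBelow.mp hd).1
    have h2 : n + 1 ≤ d.1 := h
    omega
  have hkill : ∀ ξ ∈ expoIn (fliesBelow S n s : Set Θ.Fly), w' (mono ξ) = 0 := fun ξ hξ => by
    rw [hw'a]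
    exact pivotWords_pow_mono_eq_zero hw (fun d hd => mem_fliesBelow.mp hd) hξ
  obtain ⟨m, hm, hwm⟩ := pivotWords_le_weightRestrict hc _ hWs
  obtain ⟨y, hy, hmy⟩ := exists_sub_mem_of_mem_weightSpan hlam hm
  have hyF : ∀ f ∈ monoSpan (expoIn (Θ.fliesFrom (n + 1))),
      y f ∈ monoSpan (expoIn (Θ.fliesFrom (n + 1))) := fun f hf => pivotWords_map_mem hy hf
  have hwy : ∀ f ∈ monoSpan (expoIn (Θ.fliesFrom (n + 1))),
      w' f - y f ∈ monoSpan (expoDeg (fliesBelow S n s) (Θ.fliesFrom (n + 1)) 1) := fun f hf => by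
    rw [hw'a, hwm f hf]
    exact hmy f hf
  -- The induction hypothesis concerns derivations only. The Leibniz rule for `y` is inherited from
  -- `w'` on the later variables, and `y` is linear over all the others.
  let y' : Derivation K (DPRing K p S) (DPRing K p S) := Derivation.mk' y
    (leibniz_of_expoIn y (fun ξ hξ η hη => leibniz_of_sub_mem hTG hyF hwy
      (mono_mem_monoSpan hξ) (mono_mem_monoSpan hη)) fun ξ hξ x => pivotWords_mono_mul hy hξ x)
  have hlt' : p ^ s * D / lam < D :=
    (Nat.div_lt_iff_lt_mul hlam).mpr (by rw [mul_comm D]; exact Nat.mul_lt_mul_of_pos_right hlt hD)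
  obtain ⟨N, hN⟩ := ih _ hlt' (n + 1) y' hy
  have hyN : y ^ p ^ N = 0 := by
    have := coe_pMap_iterate p y' N
    rw [hN] at this
    exact this.symm
  obtain ⟨M, hM⟩ := exists_pow_apply_eq_zero (W := W ^ p ^ s) (fun ξ hξ x => by
    rw [← hw'a, ← hw'a, Derivation.leibniz, hkill ξ hξ, smul_zero, add_zero, smul_eq_mul]) hyF
    (fun f hf => by rw [← hw'a]; exact hwy f hf) (N := p ^ N) (fun f _ => by
      rw [hyN, LinearMap.zero_apply])
  -- Flies of generation `n` that are not parents escape uniformity and may have `S_a > s`, so a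
  -- separate bound is taken over the whole generation.
  obtain ⟨t, ht⟩ : ∃ t, ∀ a : Θ.gen n, S (fly a) ≤ t :=
    ⟨Finset.univ.sup fun a : Θ.gen n => S (fly a),
      fun a => Finset.le_sup (f := fun a : Θ.gen n => S (fly a)) (Finset.mem_univ a)⟩
  have hMp : M ≤ p ^ M := (Nat.lt_pow_self hp.one_lt).le
  have hnt : ∀ {i j}, i ≤ j → p ^ i ≤ p ^ j := fun h => Nat.pow_le_pow_right hp.pos h
  refine ⟨s + M + t, derivation_eq_zero fun ξ => ?_⟩
  have hlow : ∀ ξ ∈ expoIn (Θ.fliesFrom n)ᶜ, (pMap p)^[s + M + t] w (mono ξ) = 0 :=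
    fun ξ hξ => pMap_iterate_apply_eq_zero p (M := 1) (pow_pos hp.pos _) (by
      rw [pow_one, ← hW]
      exact pivotWords_mono_eq_zero hw hξ)
  have hmid : ∀ ξ ∈ expoIn {d : Θ.Fly | d.1 = n}, (pMap p)^[s + M + t] w (mono ξ) = 0 :=
    fun ξ hξ => pMap_iterate_apply_eq_zero p (M := p ^ t) (hnt (by omega)) (by
      rw [← hW]
      refine pivotWords_pow_mono_eq_zero hw (V := {d : Θ.Fly | d.1 = n}) ?_ hξ
      rintro d rfl
      exact ⟨rfl, ht d.2⟩)
  have hhigh : ∀ ξ ∈ expoIn (Θ.fliesFrom (n + 1)), (pMap p)^[s + M + t] w (mono ξ) = 0 :=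
    fun ξ hξ => pMap_iterate_apply_eq_zero p (M := p ^ s * M) ((Nat.mul_le_mul_left _ hMp).trans
      (by rw [← pow_add]; exact hnt (by omega))) (by
      rw [← hW, pow_mul]
      exact hM _ (mono_mem_monoSpan hξ))
  refine derivation_mono_eq_zero _ (fun η hη => derivation_mono_eq_zero _ hlow hmid hη) hhigh
    fun d _ => ?_
  rcases lt_trichotomy d.1 n with h | h | h
  · exact Or.inl (Or.inl (not_le.mpr h))
  · exact Or.inl (Or.inr h)
  · exact Or.inr h

/-! ### From the restricted Lie algebra to words -/

/-- The derivations lying in some span of bounded words form a Lie subalgebra closed under the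
`p`-mapping and containing the generators, so minimality applies. -/
theorem drosophila_subset {w : Derivation K (DPRing K p S) (DPRing K p S)}
    (hw : w ∈ drosophila K p S) :
    ∃ D, (w : Module.End K (DPRing K p S)) ∈ pivotWords K p S D 0 := by
  let H : LieSubalgebra K (Derivation K (DPRing K p S) (DPRing K p S)) :=
    { carrier := {w | ∃ D, (w : Module.End K (DPRing K p S)) ∈ pivotWords K p S D 0}
      add_mem' := by
        rintro u v ⟨D, hD⟩ ⟨E, hE⟩
        exact ⟨max D E, Submodule.add_mem _ (pivotWords_mono (le_max_left D E) hD)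
          (pivotWords_mono (le_max_right D E) hE)⟩
      zero_mem' := ⟨0, Submodule.zero_mem _⟩
      smul_mem' := by
        rintro c u ⟨D, hD⟩
        exact ⟨D, Submodule.smul_mem _ c hD⟩
      lie_mem' := by
        rintro u v ⟨D, hD⟩ ⟨E, hE⟩
        refine ⟨D + E, ?_⟩
        have h := Submodule.sub_mem _ (mul_mem_pivotWords hD hE)
          (pivotWords_mono (add_comm E D).le (mul_mem_pivotWords hE hD))
        exact h }
  have hle : drosophila K p S ≤ H := by
    refine sInf_le ⟨?_, ?_⟩
    · rintro _ ⟨a, rfl⟩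
      exact ⟨1, pivotEnd_mem a⟩
    · rintro u ⟨D, hD⟩
      exact ⟨p * D, pow_mem_pivotWords hD (Fact.out : p.Prime).pos⟩
  exact hle hw

end Specie

end

theorem theorem6p1 {K : Type*} [Field K] (p : ℕ) [Fact p.Prime] [CharP K p]
    {k : ℕ} (Θ : Specie k) (S : Θ.Fly → ℕ) (hS : ∀ a, 1 ≤ S a) (hunif : Specie.IsUniform S) :
    ∀ w ∈ Specie.drosophila K p S, ∃ N : ℕ, (pMap p)^[N] w = 0 := by
  intro w hw
  obtain ⟨D, hD⟩ := Specie.drosophila_subset hw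
  exact Specie.pMap_iterate_eq_zero hS hunif D 0 w hD
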